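/- **Definitions.** An election consists of a set $\mathcal C$ of $m\ge 2$ candidates, a set $\mathcal V$ of $n$ voters, a profile $P=(\succ_v)_{v\in\mathcal V}$ of linear orders on $\mathcal C$ (the votes), and a voting rule $r$ given by a scoring vector $\alpha\in\mathbb Q^m$ with $\alpha_1\ge\alpha_2\ge\dots\ge\alpha_m$ and $\alpha_1>\alpha_m$ together with a tie-breaking linear order $\succ_t$ on $\mathcal C$. A candidate receives $\alpha_i$ points from each vote in which it is ranked $i$-th; the winner $r(P)$ is the candidate of maximum total score, ties being broken in favour of the candidate ranked highest by $\succ_t$. Let $x=r(P)$. For a candidate $y\ne x$, a set $M\subseteq\mathcal V$ is a *coalition of possible manipulators against $y$* if the votes of the voters in $M$ can be replaced by linear orders, each ranking $x$ above $y$, such that $y$ is the winner of the resulting profile (the votes outside $M$ being unchanged). $M$ is a *coalition of possible manipulators* if it is one against some candidate $y\neq x$. * **CPMSW**: given an election (including the rule $r$, i.e. $\alpha$ and $\succ_t$), a candidate $y$ and an integer $k\ge 0$, decide whether there is $M\subseteq\mathcal V$ with $|M|\le k$ that is a coalition of possible manipulators against $y$. * **CPMS**: given an election (including the rule $r$) and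 an integer $k\ge 0$, decide whether there is $M\subseteq\mathcal V$ with $|M|\le k$ that is a coalition of possible manipulators. Instances are written as strings over a fixed finite alphabet: the candidates are numbered, all numbers are written in binary, the rational entries of $\alpha$ as numerator and denominator, and each vote and $\succ_t$ as the list of the candidates from best to worst. **Theorem.** Restricted to instances whose scoring vector satisfies $\alpha_1-\alpha_2\le\alpha_i-\alpha_{i+1}$ for all $1\le i\le m-1$, the problems CPMSW and CPMS are in $\mathsf P$: each of them is decided by a Turing machine that, on every such instance, halts with the correct answer within a number of steps polynomial in the length of the instance. -/

import Mathlib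

namespace Manipulation

/-! ### Elections and scoring rules -/

/-- A preference (linear order) over the candidates `Fin m`, given as the bijection that sends
each candidate to its position; position `0` is the most preferred one. -/
abbrev Preference (m : ℕ) : Type := Fin m ≃ Fin m

/-- `v.Prefers a b`: the preference `v` strictly prefers `a` to `b`. -/
def Preference.Prefers {m : ℕ} (v : Preference m) (a b : Fin m) : Prop := v a < v b

/-- A scoring vector `α₁ ≥ α₂ ≥ ⋯ ≥ αₘ` with `α₁ > αₘ` (positions are numbered from `0`). -/
structure ScoringVector (m : ℕ) where
  two_le : 2 ≤ m
  α : Fin m → ℚ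
  antitone : ∀ i j : Fin m, i ≤ j → α j ≤ α i
  last_lt_first : α ⟨m - 1, by omega⟩ < α ⟨0, by omega⟩

/-- The condition `α₁ - α₂ ≤ αᵢ - αᵢ₊₁` for all `i`. -/
def ScoringVector.FirstGapMinimal {m : ℕ} (s : ScoringVector m) : Prop :=
  ∀ (i : ℕ) (h : i + 1 < m),
    s.α ⟨0, by omega⟩ - s.α ⟨1, by omega⟩ ≤ s.α ⟨i, by omega⟩ - s.α ⟨i + 1, h⟩

section Rules

variable {m : ℕ} {V : Type} [Fintype V]

/-- The score of candidate `c` in the profile `P`. -/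
def ScoringVector.score (s : ScoringVector m) (P : V → Preference m) (c : Fin m) : ℚ :=
  ∑ v, s.α (P v c)

/-- The voting correspondence: the candidates with maximum score. -/
def ScoringVector.cowinners (s : ScoringVector m) (P : V → Preference m) : Finset (Fin m) :=
  Finset.univ.filter fun c => ∀ d, s.score P d ≤ s.score P c

theorem ScoringVector.cowinners_nonempty (s : ScoringVector m) (P : V → Preference m) :
    (s.cowinners P).Nonempty := by
  have hm := s.two_le
  have : Nonempty (Fin m) := ⟨⟨0, by omega⟩⟩
  obtain ⟨c, hc⟩ := Finite.exists_max (s.score P)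
  exact ⟨c, by simp [ScoringVector.cowinners, hc]⟩

/-- Lexicographic tie breaking: the candidate of `S` that the preference `t` likes most. -/
def tieBreak (t : Preference m) (S : Finset (Fin m)) (hS : S.Nonempty) : Fin m :=
  t.symm ((S.image t).min' (hS.image t))

/-- The voting rule given by a scoring vector and a tie-breaking order. -/
def ScoringVector.winner (s : ScoringVector m) (t : Preference m) (P : V → Preference m) : Fin m :=
  tieBreak t (s.cowinners P) (s.cowinners_nonempty P)

/-! ### Coalitions of possible manipulators -/

/-- `M` is a coalition of possible manipulators against `y` for the voting rule `r` and the
profile `P`: the candidate `y` is not the current winner `r P`, and the voters in `M` can be given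
new preferences, all of them preferring the current winner to `y`, such that `y` wins. -/
def IsCoalitionAgainst (r : (V → Preference m) → Fin m) (P : V → Preference m)
    (M : Finset V) (y : Fin m) : Prop :=
  y ≠ r P ∧ ∃ Q : V → Preference m,
    (∀ v, v ∉ M → Q v = P v) ∧ (∀ v, v ∈ M → (Q v).Prefers (r P) y) ∧ r Q = y

/-- `M` is a coalition of possible manipulators (against some candidate). -/
def IsCoalition (r : (V → Preference m) → Fin m) (P : V → Preference m) (M : Finset V) : Prop :=
  ∃ y, IsCoalitionAgainst r P M y

end Rules

/-! ### Input format

An input is a list of rows of integers, written over a five-letter alphabet. -/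

/-- The input alphabet. -/
inductive Letter : Type
  | bit (b : Bool)
  | minus
  | comma
  | bar
  deriving DecidableEq, Fintype

/-- An integer in signed binary notation (least significant bit first), ended by a comma. -/
def writeInt (z : ℤ) : List Letter :=
  (if z < 0 then [Letter.minus] else []) ++ z.natAbs.bits.map Letter.bit ++ [Letter.comma]

/-- A list of integers, ended by a bar. -/
def writeRow (l : List ℤ) : List Letter := l.flatMap writeInt ++ [Letter.bar]

/-- A list of rows. -/
def writeRows (L : List (List ℤ)) : List Letter := L.flatMap writeRow

/-- The candidates in the order of the preference `v`, the most preferred one first. -/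
def rowOfPreference {m : ℕ} (v : Preference m) : List ℤ :=
  List.ofFn fun p : Fin m => ((v.symm p : ℕ) : ℤ)

/-- The entries of a scoring vector, each one as numerator and denominator in lowest terms. -/
def rowOfScores {m : ℕ} (s : ScoringVector m) : List ℤ :=
  (List.ofFn s.α).flatMap fun q => [q.num, (q.den : ℤ)]

/-! ### The two decision problems -/

/-- An election: candidates `Fin m`, voters `Fin n`, a voting rule (a scoring vector and a
tie-breaking order), and the preference profile of the voters. -/
structure Election where
  m : ℕ
  n : ℕ
  scores : ScoringVector m
  tie : Preference m
  profile : Fin n → Preference m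

/-- The voting rule of an election. -/
def Election.rule (E : Election) : (Fin E.n → Preference E.m) → Fin E.m :=
  E.scores.winner E.tie

/-- The scoring vector, the tie-breaking order, and the votes. -/
def Election.rows (E : Election) : List (List ℤ) :=
  rowOfScores E.scores :: rowOfPreference E.tie ::
    List.ofFn fun i => rowOfPreference (E.profile i)

/-- An instance of CPMS, for scoring rules with `α₁ - α₂ ≤ αᵢ - αᵢ₊₁` for all `i`. -/
structure CPMSInstance where
  election : Election
  gap : election.scores.FirstGapMinimal
  k : ℕ

/-- An instance of CPMSW, for scoring rules with `α₁ - α₂ ≤ αᵢ - αᵢ₊₁` for all `i`. -/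
structure CPMSWInstance where
  election : Election
  gap : election.scores.FirstGapMinimal
  y : Fin election.m
  k : ℕ

/-- CPMS: is there a coalition of possible manipulators of size at most `k`? -/
def CPMS (I : CPMSInstance) : Prop :=
  ∃ M : Finset (Fin I.election.n), M.card ≤ I.k ∧
    IsCoalition I.election.rule I.election.profile M

/-- CPMSW: is there a coalition of possible manipulators against `y` of size at most `k`? -/
def CPMSW (I : CPMSWInstance) : Prop :=
  ∃ M : Finset (Fin I.election.n), M.card ≤ I.k ∧
    IsCoalitionAgainst I.election.rule I.election.profile M I.y

def CPMSInstance.write (I : CPMSInstance) : List Letter :=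
  writeRows ([(I.k : ℤ)] :: I.election.rows)

def CPMSWInstance.write (I : CPMSWInstance) : List Letter :=
  writeRows ([((I.y : ℕ) : ℤ), (I.k : ℤ)] :: I.election.rows)

/-! ### The input format is unambiguous -/

theorem append_sep_inj {Γ : Type} {c : Γ} {a b r r' : List Γ} (ha : c ∉ a) (hb : c ∉ b)
    (h : a ++ c :: r = b ++ c :: r') : a = b ∧ r = r' := by
  induction a generalizing b with
  | nil => cases b <;> simp_all
  | cons x a ih =>
    rw [List.mem_cons, not_or] at ha
    cases b with
    | nil =>
      simp only [List.cons_append, List.nil_append, List.cons.injEq] at h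
      exact absurd h.1.symm ha.1
    | cons y b =>
      rw [List.mem_cons, not_or] at hb
      simp only [List.cons_append, List.cons.injEq] at h
      obtain ⟨h1, h2⟩ := ih ha.2 hb.2 h.2
      exact ⟨by rw [h.1, h1], h2⟩

theorem natBits_injective : Function.Injective Nat.bits := fun a b h => by
  have h2 := congrArg (List.map fun b => cond b 1 0) h
  rw [← Nat.digits_two_eq_bits, ← Nat.digits_two_eq_bits] at h2
  exact Nat.digits.injective 2 h2

theorem writeInt_append_inj {z z' : ℤ} {r r' : List Letter}
    (h : writeInt z ++ r = writeInt z' ++ r') : z = z' ∧ r = r' := by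
  have bit_inj : Function.Injective Letter.bit := fun a b h => by simpa using h
  simp only [writeInt, List.append_assoc, List.singleton_append] at h
  rw [← List.append_assoc, ← List.append_assoc] at h
  have key := append_sep_inj (by split_ifs <;> simp) (by split_ifs <;> simp) h
  refine ⟨?_, key.2⟩
  have k := key.1
  have nb : ∀ (a b : List Bool), Letter.minus :: a.map Letter.bit ≠ b.map Letter.bit := by
    intro a b hab
    cases b <;> simp at hab
  split_ifs at k with h1 h2 h2
  · simp only [List.singleton_append, List.cons.injEq, true_and] at k
    have := natBits_injective (List.map_injective_iff.2 bit_inj k)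
    omega
  · exact absurd k (nb _ _)
  · exact absurd k.symm (nb _ _)
  · have := natBits_injective (List.map_injective_iff.2 bit_inj k)
    omega

/-- Concatenation of words from a code without prefixes is injective. -/
theorem flatMap_inj {X Γ : Type} {f : X → List Γ} (hne : ∀ x, f x ≠ [])
    (hf : ∀ {x x' : X} {r r' : List Γ}, f x ++ r = f x' ++ r' → x = x' ∧ r = r') :
    ∀ {l l' : List X}, l.flatMap f = l'.flatMap f → l = l'
  | [], [], _ => rfl
  | [], x :: l, h => by simp [List.flatMap_cons, hne] at h
  | x :: l, [], h => by simp [List.flatMap_cons, hne] at h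
  | x :: l, x' :: l', h => by
    simp only [List.flatMap_cons] at h
    obtain ⟨h1, h2⟩ := hf h
    rw [h1, flatMap_inj hne hf h2]

theorem writeRow_append_inj {l l' : List ℤ} {r r' : List Letter}
    (h : writeRow l ++ r = writeRow l' ++ r') : l = l' ∧ r = r' := by
  have nb : ∀ l : List ℤ, Letter.bar ∉ l.flatMap writeInt := by
    intro l hl
    obtain ⟨z, -, hz⟩ := List.mem_flatMap.1 hl
    simp only [writeInt] at hz
    split_ifs at hz <;> simp at hz
  simp only [writeRow, List.append_assoc, List.singleton_append] at h
  have key := append_sep_inj (nb _) (nb _) h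
  exact ⟨flatMap_inj (by simp [writeInt]) writeInt_append_inj key.1, key.2⟩

theorem writeRows_injective : Function.Injective writeRows := fun _ _ h =>
  flatMap_inj (by simp [writeRow]) writeRow_append_inj h

theorem rowOfPreference_injective {m : ℕ} :
    Function.Injective (rowOfPreference : Preference m → List ℤ) := fun v w h => by
  have h1 := List.ofFn_injective h
  have h2 : v.symm = w.symm := by
    ext p
    exact_mod_cast congrFun h1 p
  simpa using congrArg Equiv.symm h2

theorem length_rowOfPreference {m : ℕ} (v : Preference m) : (rowOfPreference v).length = m := by
  simp [rowOfPreference]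

theorem rowOfScores_injective {m : ℕ} :
    Function.Injective (rowOfScores : ScoringVector m → List ℤ) := fun s s' h => by
  have h1 : List.ofFn s.α = List.ofFn s'.α := by
    refine flatMap_inj (by simp) ?_ h
    intro q q' r r' e
    simp only [List.cons_append, List.nil_append, List.cons.injEq, Nat.cast_inj] at e
    exact ⟨Rat.ext e.1 e.2.1, e.2.2⟩
  have h2 := List.ofFn_injective h1
  cases s; cases s'; simp_all

theorem Election.rows_injective : Function.Injective Election.rows := by
  rintro ⟨m, n, s, t, P⟩ ⟨m', n', s', t', P'⟩ h
  simp only [Election.rows, List.cons.injEq] at h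
  obtain ⟨h1, h2, h3⟩ := h
  obtain rfl : m = m' := by
    simpa [length_rowOfPreference] using congrArg List.length h2
  obtain rfl : n = n' := by simpa using congrArg List.length h3
  obtain rfl := rowOfScores_injective h1
  obtain rfl := rowOfPreference_injective h2
  have h4 := List.ofFn_injective h3
  obtain rfl : P = P' := by
    funext i
    exact rowOfPreference_injective (congrFun h4 i)
  rfl

theorem CPMSInstance.write_injective : Function.Injective CPMSInstance.write := by
  rintro ⟨E, g, k⟩ ⟨E', g', k'⟩ h
  have h' := writeRows_injective h
  simp only [List.cons.injEq, Nat.cast_inj, and_true] at h'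
  obtain ⟨rfl, h2⟩ := h'
  obtain rfl := Election.rows_injective h2
  rfl

theorem CPMSWInstance.write_injective : Function.Injective CPMSWInstance.write := by
  rintro ⟨E, g, y, k⟩ ⟨E', g', y', k'⟩ h
  have h' := writeRows_injective h
  simp only [List.cons.injEq, Nat.cast_inj, and_true] at h'
  obtain ⟨⟨h1, rfl⟩, h2⟩ := h'
  obtain rfl := Election.rows_injective h2
  obtain rfl := Fin.ext h1
  rfl

noncomputable def cpmsEncoding : Computability.Encoding CPMSInstance Letter where
  encode := CPMSInstance.write
  decode := Function.partialInv CPMSInstance.write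
  decode_encode := Function.partialInv_left CPMSInstance.write_injective

noncomputable def cpmswEncoding : Computability.Encoding CPMSWInstance Letter where
  encode := CPMSWInstance.write
  decode := Function.partialInv CPMSWInstance.write
  decode_encode := Function.partialInv_left CPMSWInstance.write_injective

/-! ### The class P -/

open Classical in
/-- The decision problem `L`, with inputs encoded by `e`, is in P: some Turing machine, on every
encoded input, halts within a number of steps bounded by a polynomial in the length of the encoding
and outputs whether the input is in `L`. -/
def InP {X Γ : Type} (e : Computability.Encoding X Γ) (L : X → Prop) : Prop :=
  Nonempty (Turing.TM2ComputableInPolyTime e.encode Computability.encodeBool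
    fun x => decide (L x))

end Manipulation

/-!
Let `x` be the winner. By the gap condition, a manipulator who must rank `x` above `y` serves `y`
best by moving `x` to the first and `y` to the second place: the score of `y` falls short of that
of `x` by `α₁ - α₂` in this vote, which is the least possible. The score of `x` does not decrease
and those of the candidates other than `x` and `y` do not increase, so `y` wins as soon as it
overtakes `x`. Hence every voter contributes a fixed gain, and at most `k` voters can make `y` the
winner if and only if some sum of at most `k` gains makes up for the deficit of `y` against `x`
(strictly, if ties go to `x`).

The largest sum of at most `k` of the numbers `g v` is the minimum of `k * τ + ∑ v, max (g v - τ) 0`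
over `τ ≥ 0`, attained at `τ = 0` or at one of the `g v`. Comparing the deficit with each of these
values decides the problem without sorting.

For the running time, data are coded as bit strings that programs process on a few stacks, and such
programs compile to `TM2` machines. Functions computable in polynomial time are closed under
composition, and under folding over a list as long as the size of the accumulator is bounded by a
polynomial.
-/

namespace Manipulation

/-! ### Winners and coalitions -/

/-- The inequality `a ≤ b`, where equality is allowed only if `w` holds: the criterion for a
candidate with score `b` to beat one with score `a`, if `w` says that ties go to the former. -/
def LeTie (w : Prop) (a b : ℚ) : Prop := a ≤ b ∧ (a = b → w)

theorem LeTie.mono {w : Prop} {a b c : ℚ} (h : LeTie w a b) (hbc : b ≤ c) : LeTie w a c :=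
  ⟨h.1.trans hbc, fun hac => h.2 (h.1.antisymm (hac ▸ hbc))⟩

theorem leTie_sub_iff {w : Prop} {a b c d : ℚ} (h : b - a = d - c) :
    LeTie w a b ↔ LeTie w c d := by
  unfold LeTie
  rw [← sub_nonneg, h, sub_nonneg, ← sub_eq_zero (b := b), ← neg_inj, neg_sub, h, neg_zero,
    sub_eq_zero, eq_comm]

section

variable {m : ℕ} {V : Type} [Fintype V]

/-- The candidate `x` has maximum score, and `t` prefers it to the others with this score. -/
def ScoringVector.IsTop (s : ScoringVector m) (t : Preference m) (P : V → Preference m)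
    (x : Fin m) : Prop :=
  ∀ d, LeTie (t x ≤ t d) (s.score P d) (s.score P x)

theorem ScoringVector.isTop_winner (s : ScoringVector m) (t : Preference m)
    (P : V → Preference m) : s.IsTop t P (s.winner t P) := by
  have nonempty := s.cowinners_nonempty P
  obtain ⟨x, hx, hxt⟩ := Finset.mem_image.1 (Finset.min'_mem _ (nonempty.image t))
  have winner_eq : s.winner t P = x := by
    rw [winner, tieBreak, ← hxt, Equiv.symm_apply_apply]
  have score_le : ∀ d, s.score P d ≤ s.score P x := by simpa [cowinners] using hx
  rw [winner_eq]
  refine fun d => ⟨score_le d, fun hd => ?_⟩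
  rw [hxt]
  refine Finset.min'_le _ _ (Finset.mem_image_of_mem t ?_)
  simpa [cowinners, hd] using score_le

theorem ScoringVector.isTop_iff {s : ScoringVector m} {t : Preference m} {P : V → Preference m}
    {x : Fin m} : s.IsTop t P x ↔ s.winner t P = x := by
  refine ⟨fun h => ?_, fun h => h ▸ s.isTop_winner t P⟩
  have h' := s.isTop_winner t P
  have score_eq := (h (s.winner t P)).1.antisymm (h' x).1
  exact t.injective (((h' x).2 score_eq.symm).antisymm ((h _).2 score_eq))

/-- The advantage that `y` gains over `x`, when the voter `v` puts `x` first and `y` second. -/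
def ScoringVector.gain (s : ScoringVector m) (P : V → Preference m) (x y : Fin m) (v : V) : ℚ :=
  s.α ⟨1, s.two_le⟩ - s.α ⟨0, by have := s.two_le; omega⟩ + (s.α (P v x) - s.α (P v y))

theorem ScoringVector.score_sub_score (s : ScoringVector m) {P Q : V → Preference m}
    {M : Finset V} (hQ : ∀ v, v ∉ M → Q v = P v) (x y : Fin m) :
    s.score Q y - s.score Q x = s.score P y - s.score P x +
      ∑ v ∈ M, (s.α (Q v y) - s.α (Q v x) + (s.α (P v x) - s.α (P v y))) := by
  have sum_eq : ∑ v ∈ M, (s.α (Q v y) - s.α (Q v x) + (s.α (P v x) - s.α (P v y))) =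
      ∑ v, (s.α (Q v y) - s.α (Q v x) + (s.α (P v x) - s.α (P v y))) := by
    refine Finset.sum_subset (Finset.subset_univ M) fun v _ hv => ?_
    rw [hQ v hv]
    ring
  rw [sum_eq]
  simp only [score, Finset.sum_add_distrib, Finset.sum_sub_distrib]
  ring

theorem ScoringVector.FirstGapMinimal.le_sub {s : ScoringVector m} (hs : s.FirstGapMinimal)
    {i j : Fin m} (hij : i < j) :
    s.α ⟨0, by have := s.two_le; omega⟩ - s.α ⟨1, s.two_le⟩ ≤ s.α i - s.α j := by
  have hi : (i : ℕ) + 1 < m := by omega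
  exact (hs i hi).trans (sub_le_sub_left (s.antitone ⟨i + 1, hi⟩ j hij) _)

theorem ScoringVector.FirstGapMinimal.score_sub_score_le {s : ScoringVector m}
    (hs : s.FirstGapMinimal) {P Q : V → Preference m} {M : Finset V} {x y : Fin m}
    (hQ : ∀ v, v ∉ M → Q v = P v) (hpref : ∀ v, v ∈ M → (Q v).Prefers x y) :
    s.score Q y - s.score Q x ≤ s.score P y - s.score P x + ∑ v ∈ M, s.gain P x y v := by
  rw [s.score_sub_score hQ]
  gcongr with v hv
  have := hs.le_sub (hpref v hv)
  rw [gain]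
  linarith

theorem exists_move_first (v : Preference m) (x : Fin m) :
    ∃ w : Preference m, (w x : ℕ) = 0 ∧ (∀ c, c ≠ x → v c ≤ w c) ∧
      ∀ c, v c < v x → (w c : ℕ) = v c + 1 := by
  have : NeZero m := ⟨by have := x.isLt; omega⟩
  refine ⟨v.trans (Fin.cycleRange (v x)), by simp, fun c hc => ?_, fun c h => ?_⟩
  · rcases (v.injective.ne hc).lt_or_gt with h | h
    · rw [Fin.le_def, Equiv.trans_apply, Fin.coe_cycleRange_of_lt h]
      omega
    · rw [Equiv.trans_apply, Fin.cycleRange_of_gt h]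
  · rw [Equiv.trans_apply, Fin.coe_cycleRange_of_lt h]

theorem exists_move_first_second (v : Preference m) {x y : Fin m} (hxy : y ≠ x) :
    ∃ w : Preference m, (w x : ℕ) = 0 ∧ (w y : ℕ) = 1 ∧ ∀ c, c ≠ x → c ≠ y → v c ≤ w c := by
  obtain ⟨u, u_y, le_u, -⟩ := exists_move_first v y
  obtain ⟨w, w_x, le_w, w_of_lt⟩ := exists_move_first u x
  have lt : u y < u x := by
    refine lt_of_le_of_ne ?_ (u.injective.ne hxy)
    rw [Fin.le_def, u_y]
    exact Nat.zero_le _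
  exact ⟨w, w_x, by rw [w_of_lt y lt, u_y], fun c hx hy => (le_u c hy).trans (le_w c hx)⟩

theorem ScoringVector.exists_manipulation (s : ScoringVector m) (P : V → Preference m)
    (M : Finset V) {x y : Fin m} (hxy : y ≠ x) :
    ∃ Q : V → Preference m, (∀ v, v ∉ M → Q v = P v) ∧ (∀ v, v ∈ M → (Q v).Prefers x y) ∧
      s.score Q y - s.score Q x = s.score P y - s.score P x + ∑ v ∈ M, s.gain P x y v ∧
      s.score P x ≤ s.score Q x ∧ ∀ c, c ≠ x → c ≠ y → s.score Q c ≤ s.score P c := by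
  classical
  choose w w_x w_y le_w using fun v => exists_move_first_second (P v) hxy
  let Q : V → Preference m := fun v => if v ∈ M then w v else P v
  have hQ : ∀ v, v ∉ M → Q v = P v := fun v hv => if_neg hv
  have hQM : ∀ v, v ∈ M → Q v = w v := fun v hv => if_pos hv
  refine ⟨Q, hQ, fun v hv => ?_, ?_, ?_, fun c hx hy => ?_⟩
  · rw [hQM v hv, Preference.Prefers, Fin.lt_def, w_x, w_y]
    exact one_pos
  · rw [s.score_sub_score hQ]
    congr 1
    refine Finset.sum_congr rfl fun v hv => ?_
    have first : w v x = ⟨0, by have := s.two_le; omega⟩ := Fin.ext (w_x v)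
    have second : w v y = ⟨1, s.two_le⟩ := Fin.ext (w_y v)
    rw [hQM v hv, gain, first, second]
  · refine Finset.sum_le_sum fun v _ => ?_
    by_cases hv : v ∈ M
    · exact s.antitone _ _ (by rw [hQM v hv, Fin.le_def, w_x]; exact Nat.zero_le _)
    · rw [hQ v hv]
  · refine Finset.sum_le_sum fun v _ => ?_
    by_cases hv : v ∈ M
    · exact s.antitone _ _ (by rw [hQM v hv]; exact le_w v c hx hy)
    · rw [hQ v hv]

theorem ScoringVector.FirstGapMinimal.isCoalitionAgainst_iff {s : ScoringVector m}
    (hs : s.FirstGapMinimal) (t : Preference m) (P : V → Preference m) (M : Finset V)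
    (y : Fin m) :
    IsCoalitionAgainst (s.winner t) P M y ↔ y ≠ s.winner t P ∧
      LeTie (t y ≤ t (s.winner t P)) (s.score P (s.winner t P) - s.score P y)
        (∑ v ∈ M, s.gain P (s.winner t P) y v) := by
  rw [IsCoalitionAgainst]
  have hx := s.isTop_winner t P
  generalize s.winner t P = x at hx
  refine and_congr_right fun hxy => ⟨?_, fun h => ?_⟩
  · rintro ⟨Q, hQ, hpref, winner_eq⟩
    have : LeTie (t y ≤ t x) (s.score P x - s.score P y)
        (s.score Q y - s.score Q x - (s.score P y - s.score P x)) :=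
      (leTie_sub_iff (by ring)).1 (isTop_iff.2 winner_eq x)
    exact this.mono (sub_le_iff_le_add'.2 (hs.score_sub_score_le hQ hpref))
  · obtain ⟨Q, hQ, hpref, diff, score_x, score_le⟩ := s.exists_manipulation P M hxy
    have y_beats_x : LeTie (t y ≤ t x) (s.score Q x) (s.score Q y) :=
      (leTie_sub_iff (by rw [diff]; ring)).2 h
    refine ⟨Q, hQ, hpref, isTop_iff.1 fun c => ?_⟩
    by_cases hcx : c = x
    · exact hcx ▸ y_beats_x
    by_cases hcy : c = y
    · exact hcy ▸ ⟨le_rfl, fun _ => le_rfl⟩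
    have c_le := (score_le c hcx hcy).trans ((hx c).1.trans score_x)
    refine ⟨c_le.trans y_beats_x.1, fun hc => (y_beats_x.2 ?_).trans ((hx c).2 ?_)⟩
    · exact y_beats_x.1.antisymm (hc ▸ c_le)
    · linarith [(hx c).1, score_le c hcx hcy, y_beats_x.1]

end

/-! ### The largest sum of `k` numbers -/

theorem exists_threshold {V R : Type*} [Fintype V] [Zero R] [LinearOrder R] (g : V → R) (k : ℕ) :
    ∃ τ ∈ insert 0 (Set.range g), 0 ≤ τ ∧ (Finset.univ.filter fun v => τ < g v).card ≤ k ∧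
      (τ = 0 ∨ k ≤ (Finset.univ.filter fun v => τ ≤ g v).card) := by
  classical
  let S : Finset R := insert 0 <|
    (Finset.univ.image g).filter fun σ => 0 ≤ σ ∧ k ≤ (Finset.univ.filter fun v => σ ≤ g v).card
  have mem_S (σ : R) : σ ∈ S ↔ σ = 0 ∨ (∃ v, g v = σ) ∧ 0 ≤ σ ∧
      k ≤ (Finset.univ.filter fun v => σ ≤ g v).card := by simp [S]
  have zero_mem : 0 ∈ S := Finset.mem_insert_self ..
  obtain ⟨τ, max_mem, le_max⟩ := S.exists_max_image id ⟨0, zero_mem⟩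
  have nonneg : 0 ≤ τ := le_max 0 zero_mem
  refine ⟨τ, ((mem_S τ).1 max_mem).imp_right And.left, nonneg, ?_,
    ((mem_S τ).1 max_mem).imp_right fun h => h.2.2⟩
  -- Otherwise the smallest value above `τ` would be a larger element of `S`.
  by_contra! card_lt
  have nonempty := Finset.card_pos.1 (k.zero_le.trans_lt card_lt)
  obtain ⟨u, hu, min_u⟩ := Finset.exists_min_image _ g nonempty
  have lt_u : τ < g u := (Finset.mem_filter.1 hu).2
  refine (le_max (g u) ((mem_S _).2 (.inr ⟨⟨u, rfl⟩, nonneg.trans lt_u.le, ?_⟩))).not_gt lt_u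
  exact card_lt.le.trans <| Finset.card_le_card fun v hv => by simpa using min_u v hv

section Relaxation

variable {V R : Type*} [Fintype V] [AddCommGroup R] [LinearOrder R] [IsOrderedAddMonoid R]
  (g : V → R)

theorem sum_le_relaxation {k : ℕ} {M : Finset V} (hM : M.card ≤ k) {τ : R} (hτ : 0 ≤ τ) :
    ∑ v ∈ M, g v ≤ k • τ + ∑ v, max (g v - τ) 0 :=
  calc ∑ v ∈ M, g v = M.card • τ + ∑ v ∈ M, (g v - τ) := by
        rw [Finset.sum_sub_distrib, Finset.sum_const, add_sub_cancel]
    _ ≤ k • τ + ∑ v ∈ M, max (g v - τ) 0 :=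
        add_le_add (nsmul_le_nsmul_left hτ hM) (Finset.sum_le_sum fun v _ => le_max_left _ _)
    _ ≤ k • τ + ∑ v, max (g v - τ) 0 :=
        add_le_add_right (Finset.sum_le_univ_sum_of_nonneg fun v => le_max_right _ _) _

theorem sum_eq_relaxation {k : ℕ} {M : Finset V} {τ : R} (mem_of_lt : ∀ v, τ < g v → v ∈ M)
    (le_of_mem : ∀ v ∈ M, τ ≤ g v) (hk : M.card • τ = k • τ) :
    ∑ v ∈ M, g v = k • τ + ∑ v, max (g v - τ) 0 :=
  calc ∑ v ∈ M, g v = k • τ + ∑ v ∈ M, (g v - τ) := by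
        rw [Finset.sum_sub_distrib, Finset.sum_const, hk, add_sub_cancel]
    _ = k • τ + ∑ v ∈ M, max (g v - τ) 0 := congrArg _ <|
        Finset.sum_congr rfl fun v hv => (max_eq_left (sub_nonneg.2 (le_of_mem v hv))).symm
    _ = k • τ + ∑ v, max (g v - τ) 0 := congrArg _ <|
        Finset.sum_subset (Finset.subset_univ M) fun v _ hv =>
          max_eq_right (sub_nonpos.2 (not_lt.1 fun h => hv (mem_of_lt v h)))

theorem exists_sum_eq_relaxation (k : ℕ) :
    ∃ M : Finset V, M.card ≤ k ∧ ∃ τ ∈ insert 0 (Set.range g), 0 ≤ τ ∧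
      ∑ v ∈ M, g v = k • τ + ∑ v, max (g v - τ) 0 := by
  obtain ⟨τ, mem, nonneg, card_le, rfl | le_card⟩ := exists_threshold g k
  · exact ⟨_, card_le, 0, mem, le_rfl, sum_eq_relaxation g (by simp)
      (fun v hv => (Finset.mem_filter.1 hv).2.le) (by simp)⟩
  · obtain ⟨M, lt_sub, sub_le, card_eq⟩ := Finset.exists_subsuperset_card_eq
      (Finset.monotone_filter_right _ fun v _ hv => le_of_lt hv) card_le le_card
    exact ⟨M, card_eq.le, τ, mem, nonneg, sum_eq_relaxation g
      (fun v hv => lt_sub (by simpa using hv)) (fun v hv => (Finset.mem_filter.1 (sub_le hv)).2)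
      (by rw [card_eq])⟩

theorem exists_sum_iff_relaxation (k : ℕ) {p : R → Prop} (hp : Monotone p) :
    (∃ M : Finset V, M.card ≤ k ∧ p (∑ v ∈ M, g v)) ↔
      ∀ τ ∈ insert 0 (Set.range g), 0 ≤ τ → p (k • τ + ∑ v, max (g v - τ) 0) := by
  constructor
  · rintro ⟨M, hM, h⟩ τ - hτ
    exact hp (sum_le_relaxation g hM hτ) h
  · intro h
    obtain ⟨M, hM, τ, mem, nonneg, sum_eq⟩ := exists_sum_eq_relaxation g k
    exact ⟨M, hM, sum_eq ▸ h τ mem nonneg⟩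

end Relaxation

/-! ### Stack programs and their compilation to Turing machines -/

section StackPrograms

open Turing Function

variable {R Γ : Type}

/-- Structured programs for a machine with a variable, which holds at most one letter of the
alphabet `Γ`, and a stack of letters for each register in `R`. Loops and conditionals test the
variable. -/
inductive Prog (R Γ : Type) : Type
  | skip
  | push (r : R) (f : Option Γ → Γ)
  | pop (r : R)
  | seq (p q : Prog R Γ)
  | ite (c : Option Γ → Bool) (p q : Prog R Γ)
  | loop (c : Option Γ → Bool) (p : Prog R Γ)

/-- The memory of a stack program: the variable and the stacks. -/
structure Store (R Γ : Type) where
  var : Option Γ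
  stack : R → List Γ

namespace Prog

/-- Big-step semantics: `Runs p s s' t` says that `p` transforms `s` into `s'` and tests loop
conditions `t` times. Only these tests are counted, because the compiled machine makes one step
from each test to the next. -/
inductive Runs [DecidableEq R] : Prog R Γ → Store R Γ → Store R Γ → ℕ → Prop
  | skip (s) : Runs skip s s 0
  | push (r f) (s : Store R Γ) :
      Runs (push r f) s ⟨s.var, update s.stack r (f s.var :: s.stack r)⟩ 0
  | pop (r) (s : Store R Γ) :
      Runs (pop r) s ⟨(s.stack r).head?, update s.stack r (s.stack r).tail⟩ 0
  | seq {p q s s' s'' t t'} : Runs p s s' t → Runs q s' s'' t' → Runs (seq p q) s s'' (t + t')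
  | ite_true {c p q s s' t} : c s.var = true → Runs p s s' t → Runs (ite c p q) s s' t
  | ite_false {c p q s s' t} : c s.var = false → Runs q s s' t → Runs (ite c p q) s s' t
  | loop_done {c p s} : c s.var = false → Runs (loop c p) s s 1
  | loop_step {c p s s' s'' t t'} : c s.var = true → Runs p s s' t →
      Runs (loop c p) s' s'' t' → Runs (loop c p) s s'' (1 + t + t')

/-- The alphabets of the stacks of the compiled machine: the registers and an output stack, which
is `none`. -/
abbrev Alphabet (R Γ : Type) : Option R → Type
  | none => Bool
  | some _ => Γ

/-- The statements of a compiled machine with labels `Λ`. -/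
abbrev MachineStmt (R Γ Λ : Type) : Type := TM2.Stmt (Alphabet R Γ) Λ (Option Γ)

/-- The labels of the compiled program, one for each loop. -/
def Label : Prog R Γ → Type
  | seq p q => Label p ⊕ Label q
  | ite _ p q => Label p ⊕ Label q
  | loop _ p => Option (Label p)
  | skip | push _ _ | pop _ => Empty

noncomputable instance fintypeLabel : (p : Prog R Γ) → Fintype (Label p)
  | seq p q =>
      have := fintypeLabel p
      have := fintypeLabel q
      inferInstanceAs (Fintype (Label p ⊕ Label q))
  | ite _ p q =>
      have := fintypeLabel p
      have := fintypeLabel q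
      inferInstanceAs (Fintype (Label p ⊕ Label q))
  | loop _ p =>
      have := fintypeLabel p
      inferInstanceAs (Fintype (Option (Label p)))
  | skip | push _ _ | pop _ => inferInstanceAs (Fintype Empty)

section Compile

variable {Λ : Type}

/-- The statement that runs `p` up to its first loop test, where `e` embeds the labels of `p` and
`k` is the continuation. -/
def entry : (p : Prog R Γ) → (Label p → Λ) → MachineStmt R Γ Λ → MachineStmt R Γ Λ
  | skip, _, k => k
  | push r f, _, k => TM2.Stmt.push (some r) f k
  | pop r, _, k => TM2.Stmt.pop (some r) (fun _ x => x) k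
  | seq p q, e, k => entry p (e ∘ Sum.inl) (entry q (e ∘ Sum.inr) k)
  | ite c p q, e, k => TM2.Stmt.branch c (entry p (e ∘ Sum.inl) k) (entry q (e ∘ Sum.inr) k)
  | loop _ _, e, _ => TM2.Stmt.goto fun _ => e (none : Option _)

/-- The statements at the labels of `p`, where `e` embeds these labels and `k` is the
continuation. -/
def code : (p : Prog R Γ) → (Label p → Λ) → MachineStmt R Γ Λ → Label p → MachineStmt R Γ Λ
  | seq p q, e, k, Sum.inl l => code p (e ∘ Sum.inl) (entry q (e ∘ Sum.inr) k) l
  | seq _ q, e, k, Sum.inr l => code q (e ∘ Sum.inr) k l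
  | ite _ p _, e, k, Sum.inl l => code p (e ∘ Sum.inl) k l
  | ite _ _ q, e, k, Sum.inr l => code q (e ∘ Sum.inr) k l
  | loop c p, e, k, (none : Option _) =>
      TM2.Stmt.branch c (entry p (e ∘ some) (TM2.Stmt.goto fun _ => e (none : Option _))) k
  | loop _ p, e, _, (some l : Option _) =>
      code p (e ∘ some) (TM2.Stmt.goto fun _ => e (none : Option _)) l

/-- The stacks of the compiled machine, with `out` on the output stack. -/
def tapes (S : R → List Γ) (out : List Bool) : (k : Option R) → List (Alphabet R Γ k)
  | none => out
  | some r => S r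

variable [DecidableEq R]

theorem update_tapes_some (S : R → List Γ) (out : List Bool) (r : R) (l : List Γ) :
    update (tapes S out) (some r) l = tapes (update S r l) out := by
  funext k
  rcases k with _ | k
  · exact update_of_ne (by simp) _ _
  · obtain rfl | h := eq_or_ne k r
    · exact (update_self ..).trans (by simp [tapes])
    · exact (update_of_ne (by simpa using h) _ _).trans (update_of_ne h _ _).symm

/-- The machine with statements `m` gets from `c` to `c'` in `t` steps. -/
def Steps (m : Λ → MachineStmt R Γ Λ) (t : ℕ) (c c' : TM2.Cfg (Alphabet R Γ) Λ (Option Γ)) : Prop :=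
  (flip bind (TM2.step m))^[t] (some c) = some c'

theorem Steps.trans {m : Λ → MachineStmt R Γ Λ} {t t' : ℕ} {c c' c''}
    (h : Steps m t c c') (h' : Steps m t' c' c'') : Steps m (t + t') c c'' := by
  unfold Steps at *
  rw [Nat.add_comm, iterate_add_apply, h, h']

theorem Runs.steps {m : Λ → MachineStmt R Γ Λ} {p : Prog R Γ} {s s' : Store R Γ} {t : ℕ}
    (h : Runs p s s' t) (out : List Bool) :
    ∀ (e : Label p → Λ) (k : MachineStmt R Γ Λ), (∀ l, m (e l) = code p e k l) →
      Steps m t (TM2.stepAux (entry p e k) s.var (tapes s.stack out))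
        (TM2.stepAux k s'.var (tapes s'.stack out)) := by
  induction h with
  | skip => exact fun _ _ _ => rfl
  | push r f s =>
    exact fun _ k _ => congrArg (fun S => some (TM2.stepAux k s.var S)) (update_tapes_some ..)
  | pop r s =>
    exact fun _ k _ =>
      congrArg (fun S => some (TM2.stepAux k (s.stack r).head? S)) (update_tapes_some ..)
  | seq _ _ ih ih' =>
    exact fun _ _ hm => (ih _ _ fun l => hm (Sum.inl l)).trans (ih' _ _ fun l => hm (Sum.inr l))
  | ite_true hc _ ih =>
    intro e k hm
    simp only [entry, TM2.stepAux, hc, cond_true]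
    exact ih _ _ fun l => hm (Sum.inl l)
  | ite_false hc _ ih =>
    intro e k hm
    simp only [entry, TM2.stepAux, hc, cond_false]
    exact ih _ _ fun l => hm (Sum.inr l)
  | loop_done hc =>
    intro e k hm
    simp [entry, Steps, flip, hm (none : Option _), code, hc]
  | @loop_step c p s s' s'' t t' hc _ _ ih ih' =>
    intro e k hm
    have test : Steps m 1 (TM2.stepAux (entry (loop c p) e k) s.var (tapes s.stack out))
        (TM2.stepAux (entry p (e ∘ some) (TM2.Stmt.goto fun _ => e (none : Option _)))
          s.var (tapes s.stack out)) := by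
      simp [entry, Steps, flip, hm (none : Option _), code, hc]
    exact (test.trans (ih _ _ fun l => hm (some l : Option _))).trans (ih' e k hm)

/-- The last statement of a compiled machine: it outputs `acc v`, where `v` is the variable. -/
def finish (R : Type) (acc : Option Γ → Bool) : MachineStmt R Γ Λ :=
  TM2.Stmt.push none acc <| TM2.Stmt.load (fun _ => none) <| TM2.Stmt.halt

end Compile

variable [DecidableEq R] [Fintype R] [Fintype Γ]

/-- The Turing machine that reads its input from the register `r`, runs `p` and outputs whether
`acc` holds of the variable. -/
noncomputable def machine (p : Prog R Γ) (r : R) (acc : Option Γ → Bool) : FinTM2 where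
  K := Option R
  k₀ := some r
  k₁ := none
  Γ := Alphabet R Γ
  Λ := Option (Label p)
  main := none
  σ := Option Γ
  initialState := none
  Γk₀Fin := inferInstanceAs (Fintype Γ)
  m
    | none => entry p some (finish R acc)
    | some l => code p some (finish R acc) l

theorem Runs.outputsInTime {p : Prog R Γ} {r : R} {l : List Γ} {v : Option Γ} {t : ℕ}
    (h : Runs p ⟨none, update (fun _ => []) r l⟩ ⟨v, fun _ => []⟩ t) (acc : Option Γ → Bool) :
    Nonempty (TM2OutputsInTime (machine p r acc) l (some [acc v]) (t + 1)) := by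
  have init_eq : initList (machine p r acc) l =
      ⟨some none, none, tapes (update (fun _ => []) r l) []⟩ := by
    unfold initList
    congr 1
    funext k
    rcases k with _ | k
    · rfl
    · by_cases hk : k = r
      · subst hk
        exact (dif_pos rfl).trans (update_self k l fun _ => []).symm
      · simp [tapes, machine, hk]
  have first : Steps (machine p r acc).m 1 (initList (machine p r acc) l)
      (TM2.stepAux (entry p some (finish R acc)) none (tapes (update (fun _ => []) r l) [])) := by
    rw [init_eq]
    rfl
  have last : TM2.stepAux (finish R acc) v (tapes (fun _ => []) []) =
      haltList (machine p r acc) [acc v] := by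
    unfold haltList finish
    simp only [TM2.stepAux]
    congr 1
    funext k
    cases k <;> rfl
  have total := first.trans (h.steps (m := (machine p r acc).m) [] some _ fun _ => rfl)
  rw [Nat.add_comm] at total
  exact ⟨⟨t + 1, Eq.trans total (congrArg some last)⟩, le_rfl⟩

end Prog

end StackPrograms

namespace Prog

/-! ### Programs for bit strings on stacks -/

section BitStrings

open Function

variable {R Γ : Type} [DecidableEq R]

theorem Runs.cast {p : Prog R Γ} {v v' : Option Γ} {S S' S'' : R → List Γ} {t t' : ℕ}
    (h : Runs p ⟨v, S⟩ ⟨v', S'⟩ t) (hS : S' = S'') (ht : t = t') :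
    Runs p ⟨v, S⟩ ⟨v', S''⟩ t' := hS ▸ ht ▸ h

theorem runs_pop_of_eq {r : R} {S : R → List Γ} {l : List Γ} (hS : S r = l) (v : Option Γ) :
    Runs (pop r) ⟨v, S⟩ ⟨l.head?, update S r l.tail⟩ 0 := hS ▸ Runs.pop r ⟨v, S⟩

/-- Started with any value of the variable, `p` turns the stacks `S` into `S'` with at most `n`
loop tests. -/
def Exec (p : Prog R Γ) (S S' : R → List Γ) (n : ℕ) : Prop :=
  ∀ v, ∃ v' t, t ≤ n ∧ Runs p ⟨v, S⟩ ⟨v', S'⟩ t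

theorem Exec.seq {p q : Prog R Γ} {S S' S'' : R → List Γ} {n n' : ℕ}
    (h : Exec p S S' n) (h' : Exec q S' S'' n') : Exec (p.seq q) S S'' (n + n') := fun v => by
  obtain ⟨v₁, t, ht, r⟩ := h v
  obtain ⟨v₂, t', ht', r'⟩ := h' v₁
  exact ⟨v₂, t + t', add_le_add ht ht', r.seq r'⟩

theorem Exec.mono {p : Prog R Γ} {S S' : R → List Γ} {n n' : ℕ} (h : Exec p S S' n)
    (hn : n ≤ n') : Exec p S S' n' := fun v => by
  obtain ⟨v', t, ht, r⟩ := h v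
  exact ⟨v', t, ht.trans hn, r⟩

theorem Exec.cast {p : Prog R Γ} {S S' S'' : R → List Γ} {n n' : ℕ} (h : Exec p S S' n)
    (hS : S' = S'') (hn : n = n') : Exec p S S'' n' := hS ▸ hn ▸ h

/-- Push the fixed letter `l`. -/
def pushLetter (r : R) (l : Γ) : Prog R Γ := push r fun _ => l

theorem exec_pushLetter (r : R) (l : Γ) (S : R → List Γ) :
    Exec (pushLetter r l) S (update S r (l :: S r)) 0 := fun v => ⟨v, 0, le_rfl, Runs.push ..⟩

/-- Push the content of the variable. -/
def pushVar (r : R) : Prog R Letter := push r fun v => v.getD Letter.bar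

theorem runs_pushVar (r : R) (l : Letter) (S : R → List Letter) :
    Runs (pushVar r) ⟨some l, S⟩ ⟨some l, update S r (l :: S r)⟩ 0 := Runs.push ..

/-- Whether the variable holds a bit. -/
def isBit : Option Letter → Bool
  | some (Letter.bit _) => true
  | _ => false

/-- Whether the variable holds the bit `true`. -/
def isOne (v : Option Letter) : Bool := v = some (Letter.bit true)

/-- A stack with the bit string `w`, closed by a bar, on top of `l`. -/
def str (w : List Bool) (l : List Letter) : List Letter := w.map Letter.bit ++ Letter.bar :: l

@[simp] theorem str_nil (l : List Letter) : str [] l = Letter.bar :: l := rfl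

@[simp] theorem str_cons (x : Bool) (w : List Bool) (l : List Letter) :
    str (x :: w) l = Letter.bit x :: str w l := rfl

/-- The code of a pair of bit strings: the marker `true` precedes each bit of `u`, and the marker
`false` precedes `w`. -/
def pairCode (u w : List Bool) : List Bool := (u.flatMap fun x => [true, x]) ++ false :: w

theorem length_pairCode (u w : List Bool) :
    (pairCode u w).length = 2 * u.length + 1 + w.length := by
  simp only [pairCode, List.length_append, List.length_flatMap, List.length_cons, List.length_nil,
    List.map_const', List.sum_replicate, smul_eq_mul]
  ring

/-- Pop the bit string on top of `r` with its bar, and run `p` with each of its bits in the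
variable. -/
def scan (r : R) (p : Prog R Letter) : Prog R Letter := seq (pop r) (loop isBit (seq p (pop r)))

section

variable {r : R} {p : Prog R Letter} {out : Bool → R → List Letter}

theorem runs_scanLoop (hr : ∀ x, out x r = [])
    (hp : ∀ x S, Runs p ⟨some (Letter.bit x), S⟩ ⟨some (Letter.bit x), fun i => out x i ++ S i⟩ 0)
    (w : List Bool) (l : List Letter) (S : R → List Letter) :
    Runs (loop isBit (seq p (pop r))) ⟨(str w l).head?, update S r (str w l).tail⟩
      ⟨some Letter.bar, update (fun i => w.reverse.flatMap (out · i) ++ S i) r l⟩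
      (w.length + 1) := by
  induction w generalizing S with
  | nil => exact Runs.loop_done rfl
  | cons x w ih =>
    have stacks_eq : update (fun i => out x i ++ update S r (str w l) i) r (str w l).tail =
        update (fun i => out x i ++ S i) r (str w l).tail := by
      funext i
      obtain rfl | hi := eq_or_ne i r <;> simp [*]
    have body := (hp x (update S r (str w l))).seq
      (runs_pop_of_eq (r := r) (l := str w l) (by simp [hr]) _)
    rw [stacks_eq] at body
    exact (Runs.loop_step rfl body (ih fun i => out x i ++ S i)).cast (by simp)
      (by rw [List.length_cons]; ring)

theorem exec_scan (hr : ∀ x, out x r = [])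
    (hp : ∀ x S, Runs p ⟨some (Letter.bit x), S⟩ ⟨some (Letter.bit x), fun i => out x i ++ S i⟩ 0)
    {w : List Bool} {l : List Letter} {S : R → List Letter} (hS : S r = str w l) :
    Exec (scan r p) S (update (fun i => w.reverse.flatMap (out · i) ++ S i) r l)
      (w.length + 1) := fun v =>
  ⟨_, _, (Nat.zero_add _).le, (runs_pop_of_eq hS v).seq (runs_scanLoop hr hp w l S)⟩

end

/-- Remove the bit string on top of `r`. -/
def drop (r : R) : Prog R Letter := scan r skip

theorem exec_drop {r : R} {w : List Bool} {l : List Letter} {S : R → List Letter}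
    (hS : S r = str w l) : Exec (drop r) S (update S r l) (w.length + 1) := by
  refine (exec_scan (out := fun _ _ => []) (fun _ => rfl) (fun _ _ => Runs.skip _) hS).cast ?_ rfl
  simp [List.flatMap_eq_nil_iff.2]

/-- Move the bit string on top of `r` to `r'`, which reverses it. -/
def move (r r' : R) : Prog R Letter := seq (pushLetter r' Letter.bar) (scan r (pushVar r'))

theorem exec_move {r r' : R} (hr : r ≠ r') {w : List Bool} {l : List Letter} {S : R → List Letter}
    (hS : S r = str w l) :
    Exec (move r r') S (update (update S r l) r' (str w.reverse (S r'))) (w.length + 1) := by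
  have scanned := exec_scan (r := r) (p := pushVar r')
    (out := fun x i => if i = r' then [Letter.bit x] else []) (by simp [hr])
    (fun x S => (Runs.push ..).cast (by
      funext i; obtain rfl | hi := eq_or_ne i r' <;> simp [*]) rfl)
    (S := update S r' (Letter.bar :: S r')) (by rwa [update_of_ne hr])
  refine (Exec.seq (exec_pushLetter r' _ S) scanned).cast ?_ (Nat.zero_add _)
  funext i
  obtain rfl | hi := eq_or_ne i r' <;> obtain rfl | hi' := eq_or_ne i r <;>
    simp_all [str, ← List.map_eq_flatMap, Ne.symm]

/-- Replace the code of a pair on top of `r` by its second component, and push the first one,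
reversed, onto `r'`. -/
def split (r r' : R) : Prog R Letter :=
  seq (pushLetter r' Letter.bar) <| seq (pop r) <|
    loop isOne (seq (pop r) (seq (pushVar r') (pop r)))

theorem runs_splitLoop {r r' : R} (hr : r ≠ r') (u w : List Bool) (l : List Letter)
    (S : R → List Letter) :
    Runs (loop isOne (seq (pop r) (seq (pushVar r') (pop r))))
      ⟨(str (pairCode u w) l).head?, update S r (str (pairCode u w) l).tail⟩
      ⟨some (Letter.bit false),
        update (update S r (str w l)) r' (u.reverse.map Letter.bit ++ S r')⟩ (u.length + 1) := by
  induction u generalizing S with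
  | nil =>
    refine (Runs.loop_done rfl).cast ?_ rfl
    simp [pairCode, update_comm hr]
  | cons x u ih =>
    have body := (runs_pop_of_eq (update_self r (Letter.bit x :: str (pairCode u w) l) S)
      (some (Letter.bit true))).seq ((runs_pushVar r' _ _).seq (runs_pop_of_eq (r := r)
        (l := str (pairCode u w) l) (by simp [hr]) _))
    have stacks_eq : update (update (update S r (str (pairCode u w) l)) r'
        (Letter.bit x :: S r')) r (str (pairCode u w) l).tail =
        update (update S r' (Letter.bit x :: S r')) r (str (pairCode u w) l).tail := by
      rw [update_comm hr, update_idem]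
    simp only [update_idem, List.tail_cons, update_of_ne hr.symm, stacks_eq] at body
    refine (Runs.loop_step rfl body (ih _)).cast ?_ (by rw [List.length_cons]; ring)
    simp [update_comm hr]

theorem exec_split {r r' : R} (hr : r ≠ r') {u w : List Bool} {l : List Letter}
    {S : R → List Letter} (hS : S r = str (pairCode u w) l) :
    Exec (split r r') S (update (update S r (str w l)) r' (str u.reverse (S r')))
      (u.length + 1) := by
  intro v
  have popped := runs_pop_of_eq ((update_of_ne hr (Letter.bar :: S r') S).trans hS) v
  have h := (Runs.push r' (fun _ => Letter.bar) ⟨v, S⟩).seq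
    (popped.seq (runs_splitLoop hr u w l _))
  refine ⟨_, _, le_rfl, h.cast ?_ (by omega)⟩
  simp [str, update_comm hr]

end BitStrings

end Prog

/-! ### Three stacks -/

/-- The registers of the programs that compute with coded values: values stand on `A`, and `B` and
`C` hold strings that are put aside. -/
inductive Reg
  | A
  | B
  | C
  deriving DecidableEq

instance : Fintype Reg := ⟨{.A, .B, .C}, fun r => by cases r <;> simp⟩

namespace Prog

section ThreeStacks

open Function

/-- The three stacks as a function of the register. -/
def contents (a b c : List Letter) : Reg → List Letter
  | .A => a
  | .B => b
  | .C => c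

@[simp] theorem contents_A (a b c : List Letter) : contents a b c .A = a := rfl

@[simp] theorem contents_B (a b c : List Letter) : contents a b c .B = b := rfl

@[simp] theorem contents_C (a b c : List Letter) : contents a b c .C = c := rfl

@[simp] theorem update_contents_A (a b c l : List Letter) :
    update (contents a b c) .A l = contents l b c := by
  funext i; cases i <;> rfl

@[simp] theorem update_contents_B (a b c l : List Letter) :
    update (contents a b c) .B l = contents a l c := by
  funext i; cases i <;> rfl

@[simp] theorem update_contents_C (a b c l : List Letter) :
    update (contents a b c) .C l = contents a b l := by
  funext i; cases i <;> rfl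

variable {u w : List Bool} {a b c : List Letter}

theorem exec_pushLetter_A (x : Letter) :
    Exec (pushLetter .A x) (contents a b c) (contents (x :: a) b c) 0 :=
  (exec_pushLetter Reg.A x _).cast (by simp) rfl

theorem exec_pushLetter_B (x : Letter) :
    Exec (pushLetter .B x) (contents a b c) (contents a (x :: b) c) 0 :=
  (exec_pushLetter Reg.B x _).cast (by simp) rfl

theorem exec_pushLetter_C (x : Letter) :
    Exec (pushLetter .C x) (contents a b c) (contents a b (x :: c)) 0 :=
  (exec_pushLetter Reg.C x _).cast (by simp) rfl

theorem exec_move_A_B :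
    Exec (move .A .B) (contents (str w a) b c) (contents a (str w.reverse b) c) (w.length + 1) :=
  Exec.cast (exec_move (by decide) rfl) (by simp) rfl

theorem exec_move_B_A :
    Exec (move .B .A) (contents a (str w.reverse b) c) (contents (str w a) b c) (w.length + 1) :=
  Exec.cast (exec_move (by decide) rfl) (by simp) (by simp)

theorem exec_move_B_C :
    Exec (move .B .C) (contents a (str w.reverse b) c) (contents a b (str w c)) (w.length + 1) :=
  Exec.cast (exec_move (by decide) rfl) (by simp) (by simp)

theorem exec_move_C_A :
    Exec (move .C .A) (contents a b (str w.reverse c)) (contents (str w a) b c) (w.length + 1) :=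
  Exec.cast (exec_move (by decide) rfl) (by simp) (by simp)

theorem exec_move_C_B :
    Exec (move .C .B) (contents a b (str w c)) (contents a (str w.reverse b) c) (w.length + 1) :=
  Exec.cast (exec_move (by decide) rfl) (by simp) rfl

theorem exec_drop_A : Exec (drop .A) (contents (str w a) b c) (contents a b c) (w.length + 1) :=
  Exec.cast (exec_drop rfl) (by simp) rfl

theorem exec_drop_B :
    Exec (drop .B) (contents a (str w.reverse b) c) (contents a b c) (w.length + 1) :=
  Exec.cast (exec_drop rfl) (by simp) (by simp)

theorem exec_split_A_B : Exec (split .A .B) (contents (str (pairCode u w) a) b c)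
    (contents (str w a) (str u.reverse b) c) (u.length + 1) :=
  Exec.cast (exec_split (by decide) rfl) (by simp) rfl

theorem exec_split_C_B : Exec (split .C .B) (contents a b (str (pairCode u w) c))
    (contents a (str u.reverse b) (str w c)) (u.length + 1) :=
  Exec.cast (exec_split (by decide) rfl) (by simp) rfl

/-- Push onto `C` the reverse of the string on top of `A`. -/
def dup : Prog Reg Letter :=
  seq (pushLetter .B Letter.bar) <| seq (pushLetter .C Letter.bar) <|
    seq (scan .A (seq (pushVar .B) (pushVar .C))) (move .B .A)

theorem exec_dup : Exec dup (contents (str w a) b c) (contents (str w a) b (str w.reverse c))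
    (2 * w.length + 2) := by
  have scanned : Exec (scan .A (seq (pushVar .B) (pushVar .C)))
      (contents (str w a) (Letter.bar :: b) (Letter.bar :: c))
      (contents a (str w.reverse b) (str w.reverse c)) (w.length + 1) := by
    refine (exec_scan (out := fun x => contents [] [Letter.bit x] [Letter.bit x]) (fun _ => rfl)
      (fun x S => (Runs.seq (runs_pushVar ..) (runs_pushVar ..)).cast ?_ rfl) rfl).cast ?_ rfl <;>
    · funext i
      cases i <;> simp [str, ← List.map_eq_flatMap]
  refine ((exec_pushLetter_B _).seq <| (exec_pushLetter_C _).seq <|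
    scanned.seq exec_move_B_A).cast rfl ?_
  omega

/-- Replace the string on top of `A` by its pair with the reverse of the string on top of `B`,
which is removed. -/
def join : Prog Reg Letter :=
  seq (pushLetter .A (Letter.bit false)) <|
    scan .B (seq (pushVar .A) (pushLetter .A (Letter.bit true)))

theorem exec_join : Exec join (contents (str w a) (str u.reverse b) c)
    (contents (str (pairCode u w) a) b c) (u.length + 1) := by
  have scanned : Exec (scan .B (seq (pushVar .A) (pushLetter .A (Letter.bit true))))
      (contents (Letter.bit false :: str w a) (str u.reverse b) c)
      (contents (str (pairCode u w) a) b c) (u.length + 1) := by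
    refine (exec_scan (w := u.reverse) (l := b)
      (out := fun x => contents [Letter.bit true, Letter.bit x] [] [])
      (fun _ => rfl)
      (fun x S => (Runs.seq (runs_pushVar ..) (Runs.push ..)).cast ?_ rfl) rfl).cast ?_ (by simp)
    · funext i
      cases i <;> simp
    · funext i
      cases i <;> simp [str, pairCode, List.map_flatMap]
  exact ((exec_pushLetter_A _).seq scanned).cast rfl (Nat.zero_add _)

/-- Like `join`, but the string on `B` is not removed. -/
def joinKeep : Prog Reg Letter :=
  seq (pushLetter .C Letter.bar) <| seq (pushLetter .A (Letter.bit false)) <|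
    seq (scan .B (seq (pushVar .C) (seq (pushVar .A) (pushLetter .A (Letter.bit true)))))
      (move .C .B)

theorem exec_joinKeep : Exec joinKeep (contents (str w a) (str u.reverse b) c)
    (contents (str (pairCode u w) a) (str u.reverse b) c) (2 * u.length + 2) := by
  have scanned : Exec (scan .B (seq (pushVar .C) (seq (pushVar .A)
        (pushLetter .A (Letter.bit true)))))
      (contents (Letter.bit false :: str w a) (str u.reverse b) (Letter.bar :: c))
      (contents (str (pairCode u w) a) b (str u c)) (u.length + 1) := by
    refine (exec_scan (w := u.reverse) (l := b)
      (out := fun x => contents [Letter.bit true, Letter.bit x] [] [Letter.bit x])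
      (fun _ => rfl)
      (fun x S => (Runs.seq (runs_pushVar ..) (Runs.seq (runs_pushVar ..)
        (Runs.push ..))).cast ?_ rfl) rfl).cast ?_ (by simp)
    · funext i
      cases i <;> simp
    · funext i
      cases i <;> simp [str, pairCode, List.map_flatMap, ← List.map_eq_flatMap]
  refine ((exec_pushLetter_C _).seq <| (exec_pushLetter_A _).seq <|
    scanned.seq exec_move_C_B).cast rfl ?_
  omega

/-- Push the fixed string `w` onto `A`. -/
def pushStr (w : List Bool) : Prog Reg Letter :=
  w.foldr (fun x p => seq p (pushLetter .A (Letter.bit x))) (pushLetter .A Letter.bar)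

theorem exec_pushStr : Exec (pushStr w) (contents a b c) (contents (str w a) b c) 0 := by
  induction w with
  | nil => exact exec_pushLetter_A _
  | cons x w ih => exact ih.seq (exec_pushLetter_A _)

end ThreeStacks

end Prog

open Function Prog

/-! ### Functions computable in polynomial time -/

/-- Types whose elements have codes that stack programs compute with. -/
class Coded (α : Type) where
  toBits : α → List Bool

open Coded (toBits)

/-- The length of the code of `x`. -/
def size {α : Type} [Coded α] (x : α) : ℕ := (toBits x).length

instance : Coded Bool := ⟨fun b => [b]⟩

instance {α β : Type} [Coded α] [Coded β] : Coded (α × β) :=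
  ⟨fun x => pairCode (toBits x.1) (toBits x.2)⟩

instance {α : Type} [Coded α] : Coded (List α) :=
  ⟨fun l => l.foldr (fun x w => pairCode (toBits x) w) []⟩

section PolyTime

variable {α β γ : Type} [Coded α] [Coded β] [Coded γ]

theorem toBits_cons (x : α) (l : List α) : toBits (x :: l) = pairCode (toBits x) (toBits l) := rfl

@[simp] theorem size_bool (b : Bool) : size b = 1 := rfl

@[simp] theorem size_pair (x : α) (y : β) : size (x, y) = 2 * size x + 1 + size y :=
  length_pairCode _ _

@[simp] theorem size_nil : size ([] : List α) = 0 := rfl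

@[simp] theorem size_cons (x : α) (l : List α) : size (x :: l) = 2 * size x + 1 + size l :=
  length_pairCode _ _

@[simp] theorem size_append (l l' : List α) : size (l ++ l') = size l + size l' := by
  induction l with
  | nil => simp
  | cons x l ih => simp [ih, add_assoc]

@[simp] theorem size_reverse (l : List α) : size l.reverse = size l := by
  induction l with
  | nil => simp
  | cons x l ih => simp [ih, add_comm]

theorem length_le_size (l : List α) : l.length ≤ size l := by
  induction l with
  | nil => simp
  | cons x l ih => rw [List.length_cons, size_cons]; omega

theorem size_le_of_mem {x : α} {l : List α} (h : x ∈ l) : size x ≤ size l := by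
  induction l with
  | nil => simp at h
  | cons y l ih =>
    rw [size_cons]
    rcases List.mem_cons.1 h with rfl | h
    · omega
    · have := ih h
      omega

theorem size_fst_le (x : α × β) : size x.1 ≤ size x := by
  have : size x = _ := size_pair x.1 x.2
  omega

theorem size_snd_le (x : α × β) : size x.2 ≤ size x := by
  have : size x = _ := size_pair x.1 x.2
  omega

theorem monotone_eval (q : Polynomial ℕ) : Monotone fun n => q.eval n := fun m n h => by
  simp only [Polynomial.eval_eq_sum_range]
  gcongr

/-- `φ` is bounded by a polynomial in the size of its argument. -/
def PolyBounded (φ : α → ℕ) : Prop := ∃ q : Polynomial ℕ, ∀ x, φ x ≤ q.eval (size x)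

namespace PolyBounded

variable {φ ψ : α → ℕ}

theorem mono (h : PolyBounded ψ) (hφ : ∀ x, φ x ≤ ψ x) : PolyBounded φ := by
  obtain ⟨q, hq⟩ := h
  exact ⟨q, fun x => (hφ x).trans (hq x)⟩

theorem eval (h : PolyBounded φ) (q : Polynomial ℕ) : PolyBounded fun x => q.eval (φ x) := by
  obtain ⟨q', hq⟩ := h
  exact ⟨q.comp q', fun x => by rw [Polynomial.eval_comp]; exact monotone_eval q (hq x)⟩

protected theorem size : PolyBounded fun x : α => size x := ⟨Polynomial.X, by simp⟩

theorem const (n : ℕ) : PolyBounded fun _ : α => n := ⟨Polynomial.C n, by simp⟩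

theorem add (h : PolyBounded φ) (h' : PolyBounded ψ) : PolyBounded fun x => φ x + ψ x := by
  obtain ⟨q, hq⟩ := h
  obtain ⟨q', hq'⟩ := h'
  exact ⟨q + q', fun x => by rw [Polynomial.eval_add]; exact add_le_add (hq x) (hq' x)⟩

theorem mul (h : PolyBounded φ) (h' : PolyBounded ψ) : PolyBounded fun x => φ x * ψ x := by
  obtain ⟨q, hq⟩ := h
  obtain ⟨q', hq'⟩ := h'
  exact ⟨q * q', fun x => by rw [Polynomial.eval_mul]; exact Nat.mul_le_mul (hq x) (hq' x)⟩

theorem comp {χ : β → ℕ} {f : α → β} (h : PolyBounded χ) (hf : PolyBounded fun x => size (f x)) :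
    PolyBounded fun x => χ (f x) := by
  obtain ⟨q, hq⟩ := h
  exact (hf.eval q).mono fun x => hq (f x)

end PolyBounded

/-- `f` is computed in polynomial time by a stack program, which replaces the code on top of `A`
and leaves everything else on the stacks as it is. The bound on the size of the result does not
follow from the bound on the time, as only loop tests are counted; it makes composition work. -/
@[fun_prop] structure PolyTime (f : α → β) : Prop where
  exists_prog : ∃ (p : Prog Reg Letter) (n : α → ℕ), PolyBounded n ∧ ∀ x a b c,
    Exec p (contents (str (toBits x) a) b c) (contents (str (toBits (f x)) a) b c) (n x)
  polyBounded_size : PolyBounded fun x => size (f x)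

namespace PolyTime

@[fun_prop] theorem id : PolyTime fun x : α => x :=
  ⟨⟨skip, _, PolyBounded.const 0, fun _ _ _ _ v => ⟨v, 0, le_rfl, Runs.skip _⟩⟩, PolyBounded.size⟩

theorem congr_toBits {f : α → β} {g : α → γ} (h : PolyTime f)
    (hg : ∀ x, toBits (g x) = toBits (f x)) : PolyTime g := by
  obtain ⟨⟨p, n, hn, hp⟩, hb⟩ := h
  exact ⟨⟨p, n, hn, fun x a b c => by rw [hg]; exact hp x a b c⟩,
    hb.mono fun x => by rw [size, hg, size]⟩

@[fun_prop] theorem comp {g : β → γ} {f : α → β} (hg : PolyTime g) (hf : PolyTime f) :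
    PolyTime fun x => g (f x) := by
  obtain ⟨⟨p, n, hn, hp⟩, hb⟩ := hg
  obtain ⟨⟨p', n', hn', hp'⟩, hb'⟩ := hf
  exact ⟨⟨p'.seq p, _, hn'.add (hn.comp hb'), fun x a b c => (hp' x a b c).seq (hp (f x) a b c)⟩,
    hb.comp hb'⟩

@[fun_prop] theorem const (y : β) : PolyTime fun _ : α => y :=
  ⟨⟨(drop .A).seq (pushStr (toBits y)), _,
    (PolyBounded.size.add (PolyBounded.const 1)).add (PolyBounded.const 0),
    fun _ _ _ _ => exec_drop_A.seq exec_pushStr⟩, PolyBounded.const (size y)⟩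

@[fun_prop] theorem pair {f : α → β} {g : α → γ} (hf : PolyTime f) (hg : PolyTime g) :
    PolyTime fun x => (f x, g x) := by
  obtain ⟨⟨p, n, hn, hp⟩, hb⟩ := hf
  obtain ⟨⟨p', n', hn', hp'⟩, hb'⟩ := hg
  have one : PolyBounded fun _ : α => 1 := PolyBounded.const 1
  have two : PolyBounded fun _ : α => 2 := PolyBounded.const 2
  refine ⟨⟨dup.seq <| p.seq <| (move .A .B).seq <| (move .C .A).seq <| p'.seq join, fun x =>
    (2 * size x + 2) + (n x + ((size (f x) + 1) + ((size x + 1) + (n' x + (size (f x) + 1))))),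
    ?_, fun x a b c => ?_⟩, ?_⟩
  · exact ((two.mul PolyBounded.size).add two).add <| hn.add <| (hb.add one).add <|
      (PolyBounded.size.add one).add <| hn'.add <| hb.add one
  · exact exec_dup.seq <| (hp x _ _ _).seq <| exec_move_A_B.seq <|
      exec_move_C_A.seq <| (hp' x _ _ _).seq exec_join
  · exact (((two.mul hb).add one).add hb').mono fun x => (size_pair _ _).le

@[fun_prop] theorem fst : PolyTime (Prod.fst : α × β → α) := by
  have one : PolyBounded fun _ : α × β => 1 := PolyBounded.const 1
  have hb : PolyBounded fun x : α × β => size x.1 := PolyBounded.size.mono size_fst_le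
  have hb' : PolyBounded fun x : α × β => size x.2 := PolyBounded.size.mono size_snd_le
  exact ⟨⟨(split .A .B).seq ((drop .A).seq (move .B .A)), _,
    (hb.add one).add ((hb'.add one).add (hb.add one)), fun x a b c =>
    exec_split_A_B.seq (exec_drop_A.seq exec_move_B_A)⟩, hb⟩

@[fun_prop] theorem snd : PolyTime (Prod.snd : α × β → β) := by
  have one : PolyBounded fun _ : α × β => 1 := PolyBounded.const 1
  have hb : PolyBounded fun x : α × β => size x.1 := PolyBounded.size.mono size_fst_le
  exact ⟨⟨(split .A .B).seq (drop .B), _, (hb.add one).add (hb.add one), fun x a b c =>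
    exec_split_A_B.seq exec_drop_B⟩, PolyBounded.size.mono size_snd_le⟩

end PolyTime

namespace Prog

/-- Remove the code of a truth value from `A`, and run `p` or `q` according to this value. -/
def branch (p q : Prog Reg Letter) : Prog Reg Letter :=
  seq (pop .A) (ite isOne (seq (pop .A) p) (seq (pop .A) q))

theorem exec_branch {p q : Prog Reg Letter} {t : Bool} {a b c : List Letter}
    {S : Reg → List Letter} {n : ℕ} (h : Exec (bif t then p else q) (contents a b c) S n) :
    Exec (branch p q) (contents (str (toBits t) a) b c) S n := by
  intro v
  obtain ⟨v', s, hs, run⟩ := h (some Letter.bar)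
  have pop_bit : Runs (pop .A) ⟨v, contents (str (toBits t) a) b c⟩
      ⟨some (Letter.bit t), contents (Letter.bar :: a) b c⟩ 0 :=
    (Runs.pop _ _).cast (by simp [toBits]) rfl
  have pop_bar : Runs (pop .A) ⟨some (Letter.bit t), contents (Letter.bar :: a) b c⟩
      ⟨some Letter.bar, contents a b c⟩ 0 := (Runs.pop _ _).cast (by simp) rfl
  refine ⟨v', 0 + (0 + s), by omega, pop_bit.seq ?_⟩
  cases t
  · exact Runs.ite_false rfl (pop_bar.seq run)
  · exact Runs.ite_true rfl (pop_bar.seq run)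

end Prog

@[fun_prop] theorem PolyTime.cond {t : α → Bool} {f g : α → β} (ht : PolyTime t) (hf : PolyTime f)
    (hg : PolyTime g) : PolyTime fun x => bif t x then f x else g x := by
  obtain ⟨⟨p, n, hn, hp⟩, -⟩ := ht
  obtain ⟨⟨p', n', hn', hp'⟩, hb'⟩ := hf
  obtain ⟨⟨p'', n'', hn'', hp''⟩, hb''⟩ := hg
  have one : PolyBounded fun _ : α => 1 := PolyBounded.const 1
  have two : PolyBounded fun _ : α => 2 := PolyBounded.const 2
  refine ⟨⟨dup.seq <| p.seq <| branch ((move .C .A).seq p') ((move .C .A).seq p''), fun x =>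
    (2 * size x + 2) + (n x + ((size x + 1) + (n' x + n'' x))), ?_, fun x a b c => ?_⟩, ?_⟩
  · exact ((two.mul PolyBounded.size).add two).add <| hn.add <|
      (PolyBounded.size.add one).add <| hn'.add hn''
  · refine exec_dup.seq ((hp x _ _ _).seq (exec_branch ?_))
    have moved := exec_move_C_A (w := toBits x) (a := a) (b := b) (c := c)
    cases t x
    · exact (moved.seq (hp'' x a b c)).mono (Nat.add_le_add_left (Nat.le_add_left ..) _)
    · exact (moved.seq (hp' x a b c)).mono (Nat.add_le_add_left (Nat.le_add_right ..) _)
  · refine (hb'.add hb'').mono fun x => ?_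
    cases t x
    · exact Nat.le_add_left ..
    · exact Nat.le_add_right ..

/-! ### Iteration over a list -/

namespace Prog

/-- Fold `p` over the list on top of `C`, whose first letter is in the variable, with an
accumulator on `A` and a reversed parameter on `B`. -/
def foldLoop (p : Prog Reg Letter) : Prog Reg Letter :=
  loop isBit <| seq (pushVar .C) <| seq (seq (split .C .B) (seq join (seq joinKeep p))) (pop .C)

/-- Fold `p` over a list. The code on `A` is that of the parameter, the list and the initial value
of the accumulator. -/
def fold (p : Prog Reg Letter) : Prog Reg Letter :=
  seq (split .A .B) <| seq (split .A .B) <| seq (move .B .C) <|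
    seq (seq (pop .C) (foldLoop p)) (drop .B)

section Fold

variable {p : Prog Reg Letter} {w : List Bool} {h : β → α → β} {n m : ℕ}

/-- The variable and the top of `C` at the tests of `foldLoop` are written as the result of popping
the first letter of the remaining list. -/
theorem runs_foldLoop (l : List α) (s : β)
    (hp : ∀ pre x, pre ++ [x] <+: l → ∀ a b c,
      Exec p (contents (str (pairCode w (pairCode (toBits x) (toBits (pre.foldl h s)))) a) b c)
        (contents (str (toBits (h (pre.foldl h s) x)) a) b c) n)
    (hm : ∀ x ∈ l, size x ≤ m) (a b c : List Letter) :
    ∃ t ≤ l.length * (2 * m + 2 * w.length + n + 5) + 1,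
      Runs (foldLoop p)
        ⟨(str (toBits l) c).head?,
          contents (str (toBits s) a) (str w.reverse b) (str (toBits l) c).tail⟩
        ⟨some Letter.bar, contents (str (toBits (l.foldl h s)) a) (str w.reverse b) c⟩ t := by
  induction l generalizing s with
  | nil => exact ⟨1, by simp, Runs.loop_done rfl⟩
  | cons x l ih =>
    obtain ⟨t, ht, rest⟩ := ih (h s x)
      (fun pre y hy => hp (x :: pre) y (by simpa using hy)) (fun y hy => hm y (by simp [hy]))
    obtain ⟨d, ds, hd⟩ : ∃ d ds, pairCode (toBits x) (toBits l) = d :: ds := by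
      unfold pairCode
      cases toBits x <;> simp
    have body := (exec_split_C_B (u := toBits x) (w := toBits l) (a := str (toBits s) a)
      (b := str w.reverse b) (c := c)).seq (exec_join.seq
        (exec_joinKeep.seq (hp [] x (by simp) a _ (str (toBits l) c))))
    obtain ⟨v, t', ht', run_body⟩ := body (some (Letter.bit d))
    refine ⟨1 + (0 + (t' + 0)) + t, ?_, ?_⟩
    · have hx : (toBits x).length ≤ m := hm x (by simp)
      simp only [List.length_cons, Nat.add_mul, Nat.one_mul] at ht ⊢
      omega
    · rw [toBits_cons, hd] at *
      have push_back : Runs (pushVar .C) ⟨some (Letter.bit d), contents (str (toBits s) a)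
            (str w.reverse b) (str ds c)⟩
          ⟨some (Letter.bit d), contents (str (toBits s) a) (str w.reverse b)
            (str (d :: ds) c)⟩ 0 := (runs_pushVar ..).cast (by simp) rfl
      exact Runs.loop_step rfl (push_back.seq
        (run_body.seq ((Runs.pop _ _).cast (update_contents_C ..) rfl))) rest

theorem exec_fold (l : List α) (s : β)
    (hp : ∀ pre x, pre ++ [x] <+: l → ∀ a b c,
      Exec p (contents (str (pairCode w (pairCode (toBits x) (toBits (pre.foldl h s)))) a) b c)
        (contents (str (toBits (h (pre.foldl h s) x)) a) b c) n)
    (a b c : List Letter) :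
    Exec (fold p)
      (contents (str (pairCode w (pairCode (toBits l) (toBits s))) a) b c)
      (contents (str (toBits (l.foldl h s)) a) b c)
      ((w.length + 1) + ((size l + 1) + ((size l + 1) +
        ((size l * (2 * size l + 2 * w.length + n + 5) + 1) + (w.length + 1))))) := by
  refine exec_split_A_B.seq <| exec_split_A_B.seq <| exec_move_B_C.seq <|
    Exec.seq (fun v => ?_) exec_drop_B
  obtain ⟨t, ht, run⟩ := runs_foldLoop l s hp (fun _ => size_le_of_mem) a b c
  refine ⟨_, 0 + t, ?_, ((Runs.pop _ _).cast (update_contents_C ..) rfl).seq run⟩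
  rw [Nat.zero_add]
  exact ht.trans (Nat.add_le_add_right (Nat.mul_le_mul_right _ (length_le_size _)) 1)

end Fold

end Prog

theorem PolyTime.foldl {f : γ → List α} {g : γ → β} {h : γ → β → α → β} (hf : PolyTime f)
    (hg : PolyTime g) (hh : PolyTime fun x : γ × α × β => h x.1 x.2.2 x.2.1) {B : γ → ℕ}
    (hB : PolyBounded B) (size_le : ∀ c pre, pre <+: f c → size (pre.foldl (h c) (g c)) ≤ B c) :
    PolyTime fun c => (f c).foldl (h c) (g c) := by
  obtain ⟨⟨p, n, ⟨q, hq⟩, hp⟩, -⟩ := hh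
  obtain ⟨⟨p', n', hn', hp'⟩, -⟩ := PolyTime.id.pair (hf.pair hg)
  let N : γ → ℕ := fun c => q.eval (2 * size c + 1 + (2 * size (f c) + 1 + B c))
  have step_le : ∀ c pre y, pre ++ [y] <+: f c → n (c, y, pre.foldl (h c) (g c)) ≤ N c := by
    intro c pre y hy
    have := size_le_of_mem (hy.subset (by simp : y ∈ pre ++ [y]))
    have := size_le c pre ((List.prefix_append _ _).trans hy)
    refine (hq _).trans (monotone_eval q ?_)
    simp only [size_pair]
    omega
  refine ⟨⟨p'.seq (fold p), _, hn'.add ?_, fun c a b c' => (hp' c a b c').seq <|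
    exec_fold (n := N c) (f c) (g c)
      (fun pre y hy a b c' => (hp (c, y, _) a b c').mono (step_le c pre y hy)) a b c'⟩,
    hB.mono fun c => size_le c _ List.prefix_rfl⟩
  have one : PolyBounded fun _ : γ => 1 := PolyBounded.const 1
  have two : PolyBounded fun _ : γ => 2 := PolyBounded.const 2
  have hc : PolyBounded fun c : γ => size c + 1 := PolyBounded.size.add one
  have hb := hf.polyBounded_size
  have hN : PolyBounded N := (((two.mul PolyBounded.size).add one).add
    (((two.mul hb).add one).add hB)).eval q
  exact hc.add <| (hb.add one).add <| (hb.add one).add <|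
    ((hb.mul ((((two.mul hb).add (two.mul PolyBounded.size)).add hN).add
      (PolyBounded.const 5))).add one).add hc

end PolyTime

open Coded

/-! ### From programs to decision problems in P -/

/-- The code of a letter as three truth values. -/
def Letter.triple : Letter → Bool × Bool × Bool
  | .bit b => (true, b, false)
  | .minus => (false, true, true)
  | .comma => (false, true, false)
  | .bar => (false, false, false)

instance : Coded Letter := ⟨fun l => toBits l.triple⟩

@[fun_prop] theorem PolyTime.triple : PolyTime Letter.triple :=
  PolyTime.id.congr_toBits fun _ => rfl

theorem size_letter (l : Letter) : size l = 7 := by cases l <;> rfl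

theorem size_letters (l : List Letter) : size l = 15 * l.length := by
  induction l with
  | nil => rfl
  | cons x l ih =>
    rw [size_cons, size_letter, ih, List.length_cons]
    ring

/-- The part of the code of a list that belongs to the letter `l`. -/
def block (l : Letter) : List Bool := pairCode (toBits l) []

theorem toBits_letters (l : List Letter) : toBits l = l.flatMap block := by
  induction l with
  | nil => rfl
  | cons x l ih => simp [toBits_cons, pairCode, block, ih]

namespace Prog

/-- Push the values of several functions of the variable onto `r`. -/
def pushEach {R Γ : Type} (r : R) (fs : List (Option Γ → Γ)) : Prog R Γ :=
  fs.foldr (fun f p => seq (push r f) p) skip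

theorem runs_pushEach {R Γ : Type} [DecidableEq R] (r : R) (fs : List (Option Γ → Γ))
    (v : Option Γ) (S : R → List Γ) :
    Runs (pushEach r fs) ⟨v, S⟩ ⟨v, update S r ((fs.map (· v)).reverse ++ S r)⟩ 0 := by
  induction fs generalizing S with
  | nil => exact (Runs.skip _).cast (by simp) rfl
  | cons f fs ih => exact ((Runs.push r f ⟨v, S⟩).seq (ih _)).cast (by simp) rfl

/-- Push onto `B` the block of the letter in the variable. Every block has 15 bits. -/
def pushBlock : Prog Reg Letter :=
  pushEach .B <| (List.range 15).map fun i v =>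
    Letter.bit ((block (v.getD Letter.bar)).getD i false)

theorem runs_pushBlock (l : Letter) (a b c : List Letter) :
    Runs pushBlock ⟨some l, contents a b c⟩
      ⟨some l, contents a ((block l).reverse.map Letter.bit ++ b) c⟩ 0 := by
  refine (runs_pushEach ..).cast ?_ rfl
  rw [update_contents_B]
  rcases l with ⟨_ | _⟩ | _ | _ | _ <;> rfl

/-- Replace the letters on `A`, up to the bottom of the stack, by the code of their list. -/
def readAll : Prog Reg Letter :=
  seq (pushLetter .B Letter.bar) <|
    seq (seq (pop .A) (loop Option.isSome (seq pushBlock (pop .A)))) (move .B .A)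

theorem runs_readLoop (l b : List Letter) :
    Runs (loop Option.isSome (seq pushBlock (pop .A))) ⟨l.head?, contents l.tail b []⟩
      ⟨none, contents [] ((toBits l).reverse.map Letter.bit ++ b) []⟩ (l.length + 1) := by
  induction l generalizing b with
  | nil => exact Runs.loop_done rfl
  | cons x l ih =>
    have body := (runs_pushBlock x l b []).seq ((Runs.pop _ _).cast (update_contents_A ..) rfl)
    exact (Runs.loop_step rfl body (ih _)).cast (by simp [toBits_letters])
      (by rw [List.length_cons]; ring)

theorem exec_readAll (l : List Letter) :
    Exec readAll (contents l [] []) (contents (str (toBits l) []) [] []) (16 * l.length + 2) := by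
  have read : Exec (seq (pop .A) (loop Option.isSome (seq pushBlock (pop .A))))
      (contents l [Letter.bar] []) (contents [] (str (toBits l).reverse []) []) (l.length + 1) :=
    fun v => ⟨none, _, (Nat.zero_add _).le,
      ((Runs.pop _ _).cast (update_contents_A ..) rfl).seq (runs_readLoop l [Letter.bar])⟩
  refine ((exec_pushLetter_B _).seq (read.seq exec_move_B_A)).cast rfl ?_
  have := size_letters l
  rw [size] at this
  omega

/-- Read the input, run `p`, and clear the stacks, so that the computed truth value is in the
variable. -/
def decider (p : Prog Reg Letter) : Prog Reg Letter :=
  seq (seq readAll p) <| seq (pop .A) <| seq (pushVar .B) <| seq (pop .A) (pop .B)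

theorem outputsInTime_decider {p : Prog Reg Letter} {l : List Letter} {t : Bool} {n : ℕ}
    (h : Exec p (contents (str (toBits l) []) [] []) (contents (str (toBits t) []) [] []) n) :
    Nonempty (Turing.TM2OutputsInTime (machine (decider p) .A isOne) l (some [t])
      (16 * l.length + 3 + n)) := by
  obtain ⟨v, s, hs, run⟩ := (exec_readAll l).seq h none
  have clear : Runs (seq (pop .A) <| seq (pushVar .B) <| seq (pop .A) (pop .B))
      ⟨v, contents (str (toBits t) []) [] []⟩ ⟨some (Letter.bit t), contents [] [] []⟩ 0 := by
    have pop_bit : Runs (pop .A) ⟨v, contents (str (toBits t) []) [] []⟩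
        ⟨some (Letter.bit t), contents [Letter.bar] [] []⟩ 0 :=
      (Runs.pop _ _).cast (by simp [toBits]) rfl
    have store : Runs (pushVar .B) ⟨some (Letter.bit t), contents [Letter.bar] [] []⟩
        ⟨some (Letter.bit t), contents [Letter.bar] [Letter.bit t] []⟩ 0 :=
      (runs_pushVar ..).cast (by simp) rfl
    have pop_bar : Runs (pop .A) ⟨some (Letter.bit t), contents [Letter.bar] [Letter.bit t] []⟩
        ⟨some Letter.bar, contents [] [Letter.bit t] []⟩ 0 := (Runs.pop _ _).cast (by simp) rfl
    have restore : Runs (pop .B) ⟨some Letter.bar, contents [] [Letter.bit t] []⟩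
        ⟨some (Letter.bit t), contents [] [] []⟩ 0 := (Runs.pop _ _).cast (by simp) rfl
    exact pop_bit.seq (store.seq (pop_bar.seq restore))
  have init_eq : contents l [] [] = update (fun _ => []) .A l := by
    funext r
    cases r <;> rfl
  have final_eq : contents [] [] [] = fun _ => [] := by
    funext r
    cases r <;> rfl
  have total := run.seq clear
  rw [init_eq, final_eq] at total
  obtain ⟨o⟩ := total.outputsInTime isOne
  have : isOne (some (Letter.bit t)) = t := by simp [isOne]
  rw [this] at o
  exact ⟨⟨o.toEvalsTo, o.steps_le_m.trans (by omega)⟩⟩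

end Prog

theorem inP_of_polyTime {X : Type} (e : Computability.Encoding X Letter) (L : X → Prop)
    {d : List Letter → Bool} (hd : PolyTime d) (h : ∀ x, d (e.encode x) = true ↔ L x) :
    InP e L := by
  classical
  obtain ⟨⟨p, n, ⟨q, hq⟩, hp⟩, -⟩ := hd
  let time : Polynomial ℕ :=
    Polynomial.C 16 * Polynomial.X + Polynomial.C 3 + q.comp (Polynomial.C 15 * Polynomial.X)
  have decides (x : X) : Nonempty (Turing.TM2OutputsInTime (machine (decider p) .A isOne)
      ((e.encode x).map (Equiv.refl Letter).invFun) (some [decide (L x)])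
      (time.eval (e.encode x).length)) := by
    obtain ⟨o⟩ := outputsInTime_decider (hp (e.encode x) [] [] [])
    have answer : d (e.encode x) = decide (L x) := by rw [Bool.eq_iff_iff, h, decide_eq_true_iff]
    have time_le : n (e.encode x) ≤ q.eval (15 * (e.encode x).length) :=
      size_letters (e.encode x) ▸ hq _
    suffices ∀ l, l = e.encode x → Nonempty (Turing.TM2OutputsInTime (machine (decider p) .A isOne)
        l (some [decide (L x)]) (time.eval (e.encode x).length)) from this _ (List.map_id _)
    rintro _ rfl
    rw [← answer]
    refine ⟨⟨o.toEvalsTo, o.steps_le_m.trans ?_⟩⟩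
    simp only [time, Polynomial.eval_add, Polynomial.eval_mul, Polynomial.eval_C,
      Polynomial.eval_X, Polynomial.eval_comp]
    omega
  exact ⟨⟨⟨machine (decider p) .A isOne, Equiv.refl Letter, Equiv.refl Bool⟩, time,
    fun x => (decides x).some⟩⟩

/-! ### Truth values and lists -/

section ListOperations

variable {α β γ : Type} [Coded α] [Coded β] [Coded γ]

theorem size_le_of_suffix {l l' : List α} (h : l <:+ l') : size l ≤ size l' := by
  obtain ⟨t, rfl⟩ := h
  simp

theorem size_tail_le (l : List α) : size l.tail ≤ size l := size_le_of_suffix l.tail_suffix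

namespace PolyTime

theorem congr {f g : α → β} (hf : PolyTime f) (h : ∀ x, g x = f x) : PolyTime g := funext h ▸ hf

@[fun_prop] theorem not {f : α → Bool} (hf : PolyTime f) : PolyTime fun x => !f x :=
  (hf.cond (.const false) (.const true)).congr fun x => by cases f x <;> rfl

@[fun_prop] theorem and {f g : α → Bool} (hf : PolyTime f) (hg : PolyTime g) :
    PolyTime fun x => f x && g x :=
  (hf.cond hg (.const false)).congr fun x => by cases f x <;> rfl

@[fun_prop] theorem or {f g : α → Bool} (hf : PolyTime f) (hg : PolyTime g) :
    PolyTime fun x => f x || g x :=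
  (hf.cond (.const true) hg).congr fun x => by cases f x <;> rfl

@[fun_prop] theorem cons {f : γ → α} {g : γ → List α} (hf : PolyTime f) (hg : PolyTime g) :
    PolyTime fun x => f x :: g x :=
  (hf.pair hg).congr_toBits fun _ => rfl

theorem foldl_of_growth {f : γ → List α} {g : γ → β} {h : γ → β → α → β} (hf : PolyTime f)
    (hg : PolyTime g) (hh : PolyTime fun x : γ × α × β => h x.1 x.2.2 x.2.1) {ν : β → ℕ} {C : ℕ}
    (size_le : ∀ s, size s ≤ C * ν s + C) (hν : PolyBounded fun c => ν (g c)) {K : γ → ℕ}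
    (hK : PolyBounded K) (growth : ∀ c s, ∀ x ∈ f c, ν (h c s x) ≤ ν s + K c) :
    PolyTime fun c => (f c).foldl (h c) (g c) := by
  have measure_foldl_le (c : γ) (l : List α) (s : β) (hl : ∀ x ∈ l, x ∈ f c) :
      ν (l.foldl (h c) s) ≤ ν s + l.length * K c := by
    induction l generalizing s with
    | nil => simp
    | cons x l ih =>
      have step := growth c s x (hl x (by simp))
      have rest := ih (h c s x) fun y hy => hl y (by simp [hy])
      simp only [List.foldl_cons, List.length_cons, Nat.add_mul, Nat.one_mul]
      omega
  refine PolyTime.foldl (B := fun c => C * (ν (g c) + size (f c) * K c) + C) hf hg hh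
    (((PolyBounded.const C).mul (hν.add (hf.polyBounded_size.mul hK))).add
      (.const C)) fun c pre hpre => (size_le _).trans ?_
  refine Nat.add_le_add_right (Nat.mul_le_mul_left _ ?_) _
  calc ν (pre.foldl (h c) (g c))
      ≤ ν (g c) + pre.length * K c := measure_foldl_le c pre (g c) fun x hx => hpre.subset hx
    _ ≤ ν (g c) + size (f c) * K c := Nat.add_le_add_left (
        Nat.mul_le_mul_right _ (hpre.length_le.trans (length_le_size _))) _

@[fun_prop] theorem reverse {f : γ → List α} (hf : PolyTime f) :
    PolyTime fun x => (f x).reverse := by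
  have : PolyTime fun c => (f c).foldl (fun s x => x :: s) [] := by
    refine foldl_of_growth (K := fun c => 2 * size (f c) + 1) (C := 1) hf (.const _) (by fun_prop)
      (ν := size) (by simp) (.const _)
      (((PolyBounded.const 2).mul hf.polyBounded_size).add (.const 1))
      fun c s x hx => ?_
    have := size_le_of_mem hx
    rw [size_cons]
    omega
  exact this.congr fun x => by simp

theorem foldr {f : γ → List α} {g : γ → β} {h : γ → α → β → β} (hf : PolyTime f)
    (hg : PolyTime g) (hh : PolyTime fun x : γ × α × β => h x.1 x.2.1 x.2.2) {B : γ → ℕ}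
    (hB : PolyBounded B) (size_le : ∀ c suf, suf <:+ f c → size (suf.foldr (h c) (g c)) ≤ B c) :
    PolyTime fun c => (f c).foldr (h c) (g c) := by
  have : PolyTime fun c => (f c).reverse.foldl (fun s x => h c x s) (g c) := by
    refine PolyTime.foldl hf.reverse hg hh hB fun c pre hpre => ?_
    rw [← List.foldr_reverse]
    exact size_le c _ (List.reverse_prefix.1 (by rwa [List.reverse_reverse]))
  exact this.congr fun x => by rw [List.foldl_reverse]

theorem foldr_of_growth {f : γ → List α} {g : γ → β} {h : γ → α → β → β} (hf : PolyTime f)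
    (hg : PolyTime g) (hh : PolyTime fun x : γ × α × β => h x.1 x.2.1 x.2.2) {ν : β → ℕ} {C : ℕ}
    (size_le : ∀ s, size s ≤ C * ν s + C) (hν : PolyBounded fun c => ν (g c)) {K : γ → ℕ}
    (hK : PolyBounded K) (growth : ∀ c s, ∀ x ∈ f c, ν (h c x s) ≤ ν s + K c) :
    PolyTime fun c => (f c).foldr (h c) (g c) := by
  have : PolyTime fun c => (f c).reverse.foldl (fun s x => h c x s) (g c) :=
    foldl_of_growth hf.reverse hg hh size_le hν hK
      fun c s x hx => growth c s x (List.mem_reverse.1 hx)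
  exact this.congr fun x => by rw [List.foldl_reverse]

@[fun_prop] theorem headD {f : γ → List α} {g : γ → α} (hf : PolyTime f) (hg : PolyTime g) :
    PolyTime fun x => (f x).headD (g x) := by
  have : PolyTime fun c => (f c).foldr (fun x _ => x) (g c) := by
    refine PolyTime.foldr hf hg (by fun_prop) (hf.polyBounded_size.add hg.polyBounded_size)
      fun c suf hsuf => ?_
    cases suf with
    | nil => exact Nat.le_add_left ..
    | cons x l => exact (size_le_of_mem (hsuf.subset (by simp))).trans (Nat.le_add_right ..)
  exact this.congr fun x => by cases f x <;> rfl

@[fun_prop] theorem tail {f : γ → List α} (hf : PolyTime f) : PolyTime fun x => (f x).tail := by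
  have foldr_eq (l : List α) : l.foldr (fun x s => (s.2, x :: s.2)) ([], []) = (l.tail, l) := by
    induction l with
    | nil => rfl
    | cons x l ih => simp [ih]
  have : PolyTime fun c =>
      (f c).foldr (fun x (s : List α × List α) => (s.2, x :: s.2)) ([], []) := by
    refine PolyTime.foldr (B := fun c => 3 * size (f c) + 1) hf (.const _) (by fun_prop)
      (((PolyBounded.const 3).mul hf.polyBounded_size).add (.const 1)) fun c suf hsuf => ?_
    have := size_le_of_suffix hsuf
    have := size_tail_le suf
    rw [foldr_eq, size_pair]
    omega
  exact (PolyTime.fst.comp this).congr fun x => by rw [foldr_eq]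

@[fun_prop] theorem isEmpty {f : γ → List α} (hf : PolyTime f) :
    PolyTime fun x => (f x).isEmpty := by
  have : PolyTime fun c => (f c).foldr (fun _ _ => false) true :=
    PolyTime.foldr hf (.const _) (by fun_prop) (PolyBounded.const 1) fun _ _ _ => le_rfl
  exact this.congr fun x => by cases f x <;> rfl

theorem map {f : γ → List α} {h : γ → α → β} (hf : PolyTime f)
    (hh : PolyTime fun x : γ × α => h x.1 x.2) : PolyTime fun c => (f c).map (h c) := by
  obtain ⟨q, hq⟩ := hh.polyBounded_size
  have : PolyTime fun x : γ × α × List β => h x.1 x.2.1 :=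
    hh.comp (PolyTime.fst.pair (PolyTime.fst.comp .snd))
  let argumentSize : γ → ℕ := fun c => 2 * size c + 1 + size (f c)
  have hK : PolyBounded fun c => 2 * q.eval (argumentSize c) + 1 :=
    ((PolyBounded.const 2).mul (((((PolyBounded.const 2).mul .size).add (.const 1)).add
      hf.polyBounded_size).eval q)).add (.const 1)
  have : PolyTime fun c => (f c).foldr (fun x s => h c x :: s) [] := by
    refine foldr_of_growth (ν := size) (C := 1) hf (.const _) (by fun_prop) (by simp) (.const _) hK
      fun c s x hx => ?_
    have : size (h c x) ≤ q.eval (argumentSize c) := (hq (c, x)).trans <| monotone_eval q <| by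
      rw [size_pair]
      exact Nat.add_le_add_left (size_le_of_mem hx) _
    rw [size_cons]
    omega
  exact this.congr fun x => List.map_eq_foldr

theorem all {f : γ → List α} {h : γ → α → Bool} (hf : PolyTime f)
    (hh : PolyTime fun x : γ × α => h x.1 x.2) : PolyTime fun c => (f c).all (h c) := by
  have : PolyTime fun x : γ × α × Bool => h x.1 x.2.1 :=
    hh.comp (PolyTime.fst.pair (PolyTime.fst.comp .snd))
  have : PolyTime fun c => (f c).foldr (fun x s => h c x && s) true :=
    PolyTime.foldr hf (.const _) (by fun_prop) (PolyBounded.const 1) fun _ _ _ => le_rfl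
  exact this.congr fun x => by
    induction f x with
    | nil => rfl
    | cons y l ih => rw [List.all_cons, ih, List.foldr_cons]

theorem any {f : γ → List α} {h : γ → α → Bool} (hf : PolyTime f)
    (hh : PolyTime fun x : γ × α => h x.1 x.2) : PolyTime fun c => (f c).any (h c) :=
  (PolyTime.all (h := fun x y => !h x y) hf hh.not).not.congr fun _ => List.any_eq_not_all_not

end PolyTime

end ListOperations

/-! ### Arithmetic of binary numbers -/

instance : Coded ℕ := ⟨fun n => toBits n.bits⟩

theorem size_nat (n : ℕ) : size n = 3 * n.size := by
  have size_bits (l : List Bool) : size l = 3 * l.length := by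
    induction l with
    | nil => rfl
    | cons b l ih =>
      rw [size_cons, size_bool, ih, List.length_cons]
      ring
  rw [← Nat.size_eq_bits_len, ← size_bits]
  rfl

theorem size_nat_mono {m n : ℕ} (h : m ≤ n) : size m ≤ size n := by
  rw [size_nat, size_nat]
  exact Nat.mul_le_mul_left _ (Nat.size_le_size h)

theorem size_nat_mul_le (m n : ℕ) : size (m * n) ≤ size m + size n := by
  rw [size_nat, size_nat, size_nat, ← Nat.mul_add]
  refine Nat.mul_le_mul_left _ (Nat.size_le.2 ?_)
  rw [pow_add]
  exact Nat.mul_lt_mul'' (Nat.lt_size_self m) (Nat.lt_size_self n)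

theorem size_nat_add_le (m n : ℕ) : size (m + n) ≤ max (size m) (size n) + 3 := by
  have size_le : (m + n).size ≤ max m.size n.size + 1 := by
    have hm : m < 2 ^ max m.size n.size :=
      (Nat.lt_size_self m).trans_le (Nat.pow_le_pow_right two_pos (le_max_left _ _))
    have hn : n < 2 ^ max m.size n.size :=
      (Nat.lt_size_self n).trans_le (Nat.pow_le_pow_right two_pos (le_max_right _ _))
    rw [Nat.size_le, pow_succ]
    omega
  simp only [size_nat]
  omega

theorem size_bit_le (b : Bool) (n : ℕ) : size (Nat.bit b n) ≤ size n + 3 := by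
  have size_le : (Nat.bit b n).size ≤ n.size + 1 := by
    have := Nat.lt_size_self n
    rw [Nat.size_le, pow_succ, Nat.bit_val]
    cases b <;> simp only [Bool.toNat_false, Bool.toNat_true] <;> omega
  simp only [size_nat]
  omega

theorem size_nat_succ_le (n : ℕ) : size (n + 1) ≤ size n + 3 :=
  (size_nat_mono (by simp only [Nat.bit_val, Bool.toNat_true]; omega)).trans (size_bit_le true n)

theorem size_div2_le (n : ℕ) : size n.div2 ≤ size n :=
  size_nat_mono (by rw [Nat.div2_val]; exact Nat.div_le_self n 2)

/-- The number with the given binary digits, the least significant one first. -/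
def ofBits (l : List Bool) : ℕ := l.foldr Nat.bit 0

theorem ofBits_cons (b : Bool) (l : List Bool) : ofBits (b :: l) = Nat.bit b (ofBits l) := rfl

@[simp] theorem ofBits_bits (n : ℕ) : ofBits n.bits = n := by
  induction n using Nat.binaryRec' with
  | zero => rfl
  | bit b n h ih => rw [Nat.bits_append_bit _ _ h, ofBits_cons, ih]

theorem size_ofBits_le (l : List Bool) : size (ofBits l) ≤ size l := by
  induction l with
  | nil => rfl
  | cons b l ih =>
    have := size_bit_le b (ofBits l)
    rw [ofBits_cons, size_cons, size_bool]
    omega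

theorem size_ofBits_le_of_suffix {l : List Bool} {n : ℕ} (h : l <:+ n.bits) :
    size (ofBits l) ≤ size n :=
  (size_ofBits_le l).trans (size_le_of_suffix h)

section PolyTime

variable {α : Type} [Coded α]

namespace PolyTime

@[fun_prop] theorem bits {f : α → ℕ} (hf : PolyTime f) : PolyTime fun x => (f x).bits :=
  hf.congr_toBits fun _ => rfl

@[fun_prop] theorem bodd {f : α → ℕ} (hf : PolyTime f) : PolyTime fun x => (f x).bodd := by
  have : PolyTime fun x => (f x).bits.headD false := by fun_prop
  exact this.congr fun x => by
    rw [Nat.bodd_eq_bits_head]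
    cases (f x).bits <;> rfl

@[fun_prop] theorem div2 {f : α → ℕ} (hf : PolyTime f) : PolyTime fun x => (f x).div2 := by
  have : PolyTime fun x => (f x).bits.tail := by fun_prop
  exact this.congr_toBits fun x => congrArg toBits (Nat.div2_bits_eq_tail _)

theorem beq_zero {f : α → ℕ} (hf : PolyTime f) : PolyTime fun x => (f x).beq 0 := by
  have : PolyTime fun x => (f x).bits.isEmpty := by fun_prop
  exact this.congr fun x => by
    rw [Bool.eq_iff_iff, Nat.beq_eq, List.isEmpty_iff_length_eq_zero, Nat.size_eq_bits_len,
      Nat.size_eq_zero]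

@[fun_prop] theorem bit {f : α → Bool} {g : α → ℕ} (hf : PolyTime f) (hg : PolyTime g) :
    PolyTime fun x => Nat.bit (f x) (g x) := by
  have : PolyTime fun x => bif !(f x) && (g x).beq 0 then [] else f x :: (g x).bits :=
    (hf.not.and hg.beq_zero).cond (.const _) (by fun_prop)
  refine this.congr_toBits fun x => congrArg (toBits (α := List Bool)) ?_
  cases hb : f x with
  | true => rw [Nat.bits_append_bit _ _ fun _ => rfl]; rfl
  | false =>
    rcases g x with _ | n
    · rfl
    · rw [Nat.bits_append_bit _ _ fun h => absurd h n.succ_ne_zero]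
      rfl

@[fun_prop] theorem ofBits {f : α → List Bool} (hf : PolyTime f) :
    PolyTime fun x => ofBits (f x) :=
  foldr_of_growth (ν := size) (C := 1) hf (.const 0) (by fun_prop) (by simp) (.const _)
    (.const 3) fun _ s x _ => size_bit_le x s

@[fun_prop] theorem succ {f : α → ℕ} (hf : PolyTime f) : PolyTime fun x => f x + 1 := by
  let step (b : Bool) (s : ℕ × ℕ) : ℕ × ℕ :=
    (Nat.bit b s.1, bif b then Nat.bit false s.2 else Nat.bit true s.1)
  have foldr_step (l : List Bool) :
      l.foldr step (0, 1) = (Manipulation.ofBits l, Manipulation.ofBits l + 1) := by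
    induction l with
    | nil => rfl
    | cons b l ih =>
      rw [List.foldr_cons, ih, ofBits_cons]
      cases b <;> simp [step, Nat.bit_val]
      ring
  have : PolyTime fun x => (f x).bits.foldr step (0, 1) := by
    refine PolyTime.foldr (B := fun x => 3 * size (f x) + 4) hf.bits (.const _) (by fun_prop)
      (((PolyBounded.const 3).mul hf.polyBounded_size).add (.const 4)) fun x suf hsuf => ?_
    have := size_ofBits_le_of_suffix hsuf
    have := size_nat_succ_le (Manipulation.ofBits suf)
    rw [foldr_step, size_pair]
    omega
  exact (PolyTime.snd.comp this).congr fun x => by rw [foldr_step, ofBits_bits]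

end PolyTime

/-- The pairs of digits of `m` and `n` at the positions of the digits of `m`, the most significant
ones first, and the number formed by the remaining digits of `n`. -/
def padZip (m n : ℕ) : List (Bool × Bool) × ℕ :=
  m.bits.foldl (fun s x => ((x, s.2.bodd) :: s.1, s.2.div2)) ([], n)

theorem foldl_padZip {β : Type} (F : ℕ → ℕ → β) (h : β → Bool × Bool → β)
    (hF : ∀ x y m n, F (Nat.bit x m) (Nat.bit y n) = h (F m n) (x, y)) (m n : ℕ) :
    (padZip m n).1.foldl h (F 0 (padZip m n).2) = F m n := by
  let zip (l : List Bool) (s : List (Bool × Bool) × ℕ) : List (Bool × Bool) × ℕ :=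
    l.foldl (fun s x => ((x, s.2.bodd) :: s.1, s.2.div2)) s
  have foldl_zip (l : List Bool) (out : List (Bool × Bool)) (n : ℕ) :
      (zip l (out, n)).1.foldl h (F 0 (zip l (out, n)).2) = out.foldl h (F (ofBits l) n) := by
    induction l generalizing out n with
    | nil => rfl
    | cons x l ih => exact (ih _ _).trans (by rw [List.foldl_cons, ← hF, Nat.bit_bodd_div2]; rfl)
  have := foldl_zip m.bits [] n
  rwa [ofBits_bits] at this

theorem PolyTime.padZip {f g : α → ℕ} (hf : PolyTime f) (hg : PolyTime g) :
    PolyTime fun x => padZip (f x) (g x) := by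
  refine foldl_of_growth (ν := size) (C := 1) (K := fun _ => 20) hf.bits
    ((PolyTime.const []).pair hg) (by fun_prop) (by simp)
    ((PolyTime.const []).pair hg).polyBounded_size (.const _) ?_
  rintro _ ⟨out, n⟩ x -
  have := size_div2_le n
  simp only [size_pair, size_cons, size_bool]
  omega

/-- One step of the computation of a sum and its successor from the sum of the higher digits and
its successor. -/
def addStep (s : ℕ × ℕ) (x : Bool × Bool) : ℕ × ℕ :=
  bif x.1 && x.2 then (Nat.bit false s.2, Nat.bit true s.2)
  else bif x.1 || x.2 then (Nat.bit true s.1, Nat.bit false s.2)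
  else (Nat.bit false s.1, Nat.bit true s.1)

theorem size_addStep_le (s : ℕ × ℕ) (x : Bool × Bool) :
    max (size (addStep s x).1) (size (addStep s x).2) ≤ max (size s.1) (size s.2) + 3 := by
  obtain ⟨a, b⟩ := s
  have := size_bit_le true a
  have := size_bit_le false a
  have := size_bit_le true b
  have := size_bit_le false b
  rcases x with ⟨_ | _, _ | _⟩ <;> simp only [addStep, Bool.and_true, Bool.and_false, Bool.or_true,
    Bool.or_false, cond_true, cond_false] <;> omega

theorem foldl_addStep_padZip (m n : ℕ) :
    (padZip m n).1.foldl addStep ((padZip m n).2, (padZip m n).2 + 1) = (m + n, m + n + 1) := by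
  have := foldl_padZip (fun m n => (m + n, m + n + 1)) addStep ?_ m n
  · simpa only [Nat.zero_add] using this
  · rintro (_ | _) (_ | _) m n <;> simp [addStep, Nat.bit_val] <;> omega

@[fun_prop] theorem PolyTime.add {f g : α → ℕ} (hf : PolyTime f) (hg : PolyTime g) :
    PolyTime fun x => f x + g x := by
  have hz := hf.padZip hg
  have init := (snd.comp hz).pair (snd.comp hz).succ
  have : PolyTime fun x => (Manipulation.padZip (f x) (g x)).1.foldl addStep
      ((Manipulation.padZip (f x) (g x)).2, (Manipulation.padZip (f x) (g x)).2 + 1) := by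
    refine foldl_of_growth (h := fun _ => addStep) (ν := fun s => max (size s.1) (size s.2))
      (C := 3) (fst.comp hz) init (by unfold addStep; fun_prop) ?_
      (init.polyBounded_size.mono fun x => ?_) (.const 3) fun _ s x _ => size_addStep_le s x
    · intro s
      have : size s = _ := size_pair s.1 s.2
      omega
    · exact max_le (size_fst_le _) (size_snd_le _)
  exact (fst.comp this).congr fun x => by rw [foldl_addStep_padZip]

/-- One step of the computation of the truth values of `m ≤ n` and `m < n` from those for the
higher digits. -/
def leStep (s : Bool × Bool) (x : Bool × Bool) : Bool × Bool :=
  (bif x.1 && !x.2 then s.2 else s.1, bif !x.1 && x.2 then s.1 else s.2)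

theorem foldl_leStep_padZip (m n : ℕ) :
    (padZip m n).1.foldl leStep (true, decide (0 < (padZip m n).2)) =
      (decide (m ≤ n), decide (m < n)) := by
  have := foldl_padZip (fun m n => (decide (m ≤ n), decide (m < n))) leStep ?_ m n
  · simpa only [Nat.zero_le, decide_true] using this
  · rintro (_ | _) (_ | _) m n <;> simp [leStep, Nat.bit_val] <;> omega

namespace PolyTime

@[fun_prop] theorem ble {f g : α → ℕ} (hf : PolyTime f) (hg : PolyTime g) :
    PolyTime fun x => (f x).ble (g x) := by
  have hz := hf.padZip hg
  have pos : PolyTime fun x => decide (0 < (Manipulation.padZip (f x) (g x)).2) :=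
    (snd.comp hz).beq_zero.not.congr fun x => by
      rw [Bool.eq_iff_iff, decide_eq_true_iff, Bool.not_eq_true', ← Bool.not_eq_true, Nat.beq_eq,
        Nat.pos_iff_ne_zero]
  have : PolyTime fun x => (Manipulation.padZip (f x) (g x)).1.foldl leStep
      (true, decide (0 < (Manipulation.padZip (f x) (g x)).2)) :=
    PolyTime.foldl (h := fun _ => leStep) (fst.comp hz) ((const _).pair pos)
      (by unfold leStep; fun_prop) (.const 4) fun _ _ _ => (size_pair _ _).le
  exact (fst.comp this).congr fun x => by
    rw [foldl_leStep_padZip, Bool.eq_iff_iff, Nat.ble_eq, decide_eq_true_iff]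

@[fun_prop] theorem beq {f g : α → ℕ} (hf : PolyTime f) (hg : PolyTime g) :
    PolyTime fun x => (f x).beq (g x) :=
  ((hf.ble hg).and (hg.ble hf)).congr fun x => by
    rw [Bool.eq_iff_iff, Nat.beq_eq, Bool.and_eq_true, Nat.ble_eq, Nat.ble_eq, le_antisymm_iff]

@[fun_prop] theorem mul {f g : α → ℕ} (hf : PolyTime f) (hg : PolyTime g) :
    PolyTime fun x => f x * g x := by
  let step (n : ℕ) (b : Bool) (s : ℕ) : ℕ := bif b then Nat.bit false s + n else Nat.bit false s
  have foldr_step (l : List Bool) (n : ℕ) : l.foldr (step n) 0 = Manipulation.ofBits l * n := by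
    induction l with
    | nil => exact (Nat.zero_mul n).symm
    | cons b l ih =>
      rw [List.foldr_cons, ih, ofBits_cons]
      cases b <;> simp [step, Nat.bit_val] <;> ring
  have : PolyTime fun x => (f x).bits.foldr (step (g x)) 0 := by
    have : PolyTime fun x : α × Bool × ℕ => g x.1 := hg.comp fst
    refine PolyTime.foldr hf.bits (.const _) (by fun_prop)
      (hf.polyBounded_size.add hg.polyBounded_size) fun x suf hsuf => ?_
    rw [foldr_step]
    exact (size_nat_mul_le _ _).trans (Nat.add_le_add_right (size_ofBits_le_of_suffix hsuf) _)
  exact this.congr fun x => by rw [foldr_step, ofBits_bits]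

end PolyTime

end PolyTime

/-! ### Fractions -/

instance : Coded ℕ+ := ⟨fun n => toBits (n : ℕ)⟩

theorem size_pnat (n : ℕ+) : size n = size (n : ℕ) := rfl

theorem size_toPNat'_le (n : ℕ) : size n.toPNat' ≤ size n + 3 := by
  refine (size_nat_mono ?_).trans (size_nat_succ_le n)
  rw [Nat.toPNat'_coe]
  split_ifs <;> omega

/-- The fraction `(a - b) / d`, not necessarily in lowest terms, as the triple `(a, b, d)`. -/
abbrev Frac : Type := ℕ × ℕ × ℕ+

namespace Frac

/-- The rational number that a fraction represents. -/
def val (x : Frac) : ℚ := ((x.1 : ℚ) - x.2.1) / (x.2.2 : ℕ)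

/-- The fraction `0 / 1`. -/
def zero : Frac := (0, 0, 1)

/-- The sum of fractions, over the product of the denominators. -/
def add (x y : Frac) : Frac :=
  (x.1 * y.2.2 + y.1 * x.2.2, x.2.1 * y.2.2 + y.2.1 * x.2.2, x.2.2 * y.2.2)

/-- The negative of a fraction. -/
def neg (x : Frac) : Frac := (x.2.1, x.1, x.2.2)

/-- The multiple of a fraction by a natural number. -/
def smul (k : ℕ) (x : Frac) : Frac := (k * x.1, k * x.2.1, x.2.2)

/-- The comparison of fractions, after multiplication with both denominators. -/
def ble (x y : Frac) : Bool :=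
  (x.1 * y.2.2 + y.2.1 * x.2.2).ble (y.1 * x.2.2 + x.2.1 * y.2.2)

/-- The larger one of a fraction and zero. -/
def pos (x : Frac) : Frac := bif ble zero x then x else zero

/-- The sum of a list of fractions. -/
def sum (l : List Frac) : Frac := l.foldl add zero

theorem den_pos (x : Frac) : (0 : ℚ) < (x.2.2 : ℕ) := mod_cast x.2.2.pos

@[simp] theorem val_zero : val zero = 0 := by simp [val, zero]

@[simp] theorem val_add (x y : Frac) : val (add x y) = val x + val y := by
  have hx := (den_pos x).ne'
  have hy := (den_pos y).ne'
  simp only [val, add, PNat.mul_coe]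
  push_cast
  field_simp
  ring

@[simp] theorem val_neg (x : Frac) : val (neg x) = -val x := by
  simp only [val, neg]
  ring

@[simp] theorem val_smul (k : ℕ) (x : Frac) : val (smul k x) = k * val x := by
  simp only [val, smul]
  push_cast
  ring

@[simp] theorem ble_iff (x y : Frac) : ble x y = true ↔ val x ≤ val y := by
  rw [ble, Nat.ble_eq, val, val, div_le_div_iff₀ (den_pos x) (den_pos y), ← @Nat.cast_le ℚ]
  push_cast
  constructor <;> intro h <;> linarith

@[simp] theorem val_pos (x : Frac) : val (pos x) = max (val x) 0 := by
  have ble_zero := ble_iff zero x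
  rw [val_zero] at ble_zero
  unfold pos
  cases h : ble zero x with
  | true => exact (max_eq_left (ble_zero.1 h)).symm
  | false =>
    have : ¬0 ≤ val x := fun hx => by simp [ble_zero.2 hx] at h
    exact val_zero.trans (max_eq_right (le_of_not_ge this)).symm

@[simp] theorem val_sum (l : List Frac) : val (sum l) = (l.map val).sum := by
  have val_foldl (x : Frac) : val (l.foldl add x) = val x + (l.map val).sum := by
    induction l generalizing x with
    | nil => simp
    | cons y l ih =>
      rw [List.foldl_cons, ih, val_add, List.map_cons, List.sum_cons]
      ring
  rw [sum, val_foldl, val_zero, zero_add]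

/-- The size of the largest one of the three numbers in a fraction. -/
def maxSize (x : Frac) : ℕ := max (size x.1) (max (size x.2.1) (size x.2.2))

theorem maxSize_le_size (x : Frac) : maxSize x ≤ size x :=
  max_le (size_fst_le x) <| max_le ((size_fst_le x.2).trans (size_snd_le x))
    ((size_snd_le x.2).trans (size_snd_le x))

theorem size_le_maxSize (x : Frac) : size x ≤ 5 * maxSize x + 5 := by
  obtain ⟨a, b, d⟩ := x
  simp only [maxSize, size_pair]
  omega

theorem maxSize_add_le (x y : Frac) : maxSize (add x y) ≤ maxSize x + maxSize y + 3 := by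
  obtain ⟨a, b, d⟩ := x
  obtain ⟨a', b', d'⟩ := y
  simp only [maxSize, add, size_pnat, PNat.mul_coe]
  have := size_nat_mul_le a d'
  have := size_nat_mul_le a' d
  have := size_nat_mul_le b d'
  have := size_nat_mul_le b' d
  have := size_nat_mul_le d d'
  have := size_nat_add_le (a * d') (a' * d)
  have := size_nat_add_le (b * d') (b' * d)
  omega

end Frac

namespace PolyTime

variable {α : Type} [Coded α]

@[fun_prop] theorem coe_pnat {f : α → ℕ+} (hf : PolyTime f) : PolyTime fun x => (f x : ℕ) :=
  hf.congr_toBits fun _ => rfl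

@[fun_prop] theorem mul_pnat {f g : α → ℕ+} (hf : PolyTime f) (hg : PolyTime g) :
    PolyTime fun x => f x * g x :=
  (hf.coe_pnat.mul hg.coe_pnat).congr_toBits fun _ => rfl

@[fun_prop] theorem toPNat' {f : α → ℕ} (hf : PolyTime f) : PolyTime fun x => (f x).toPNat' := by
  have : PolyTime fun x => bif (f x).beq 0 then 1 else f x := by fun_prop
  refine this.congr_toBits fun x => congrArg (toBits (α := ℕ)) ?_
  cases f x <;> rfl

@[fun_prop] theorem frac_add {f g : α → Frac} (hf : PolyTime f) (hg : PolyTime g) :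
    PolyTime fun x => (f x).add (g x) := by
  unfold Frac.add
  fun_prop

@[fun_prop] theorem frac_neg {f : α → Frac} (hf : PolyTime f) : PolyTime fun x => (f x).neg := by
  unfold Frac.neg
  fun_prop

@[fun_prop] theorem frac_smul {f : α → ℕ} {g : α → Frac} (hf : PolyTime f) (hg : PolyTime g) :
    PolyTime fun x => (g x).smul (f x) := by
  unfold Frac.smul
  fun_prop

@[fun_prop] theorem frac_ble {f g : α → Frac} (hf : PolyTime f) (hg : PolyTime g) :
    PolyTime fun x => (f x).ble (g x) := by
  unfold Frac.ble
  fun_prop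

@[fun_prop] theorem frac_pos {f : α → Frac} (hf : PolyTime f) : PolyTime fun x => (f x).pos := by
  unfold Frac.pos
  fun_prop

@[fun_prop] theorem frac_sum {f : α → List Frac} (hf : PolyTime f) :
    PolyTime fun x => Frac.sum (f x) := by
  refine foldl_of_growth (h := fun _ => Frac.add) (ν := Frac.maxSize)
    (K := fun x => size (f x) + 3) hf (.const Frac.zero) (by fun_prop) Frac.size_le_maxSize
    (.const _) (hf.polyBounded_size.add (.const 3)) fun c s x hx => ?_
  have := Frac.maxSize_add_le s x
  have := (Frac.maxSize_le_size x).trans (size_le_of_mem hx)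
  omega

end PolyTime

/-! ### Reading the input -/

/-- The state of the parser: the rows, the current row, and the sign and the digits of the current
number, all of them in reverse order. -/
abbrev ParseState : Type := List (List (Bool × ℕ)) × List (Bool × ℕ) × Bool × List Bool

/-- The parser's reaction to one letter, the cases being told apart by `Letter.triple`. -/
def parseStep (s : ParseState) (l : Letter) : ParseState :=
  bif l.triple.1 then (s.1, s.2.1, s.2.2.1, l.triple.2.1 :: s.2.2.2)
  else bif l.triple.2.1 then
    bif l.triple.2.2 then (s.1, s.2.1, true, s.2.2.2)
    else (s.1, (s.2.2.1, ofBits s.2.2.2.reverse) :: s.2.1, false, [])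
  else (s.2.1.reverse :: s.1, [], false, [])

/-- The rows of integers in the input, each integer as its sign and its absolute value. -/
def parse (l : List Letter) : List (List (Bool × ℕ)) :=
  (l.foldl parseStep ([], [], false, [])).1.reverse

/-- The parsed form of an integer. -/
def ofInt (z : ℤ) : Bool × ℕ := (decide (z < 0), z.natAbs)

section ParseWrite

variable (r : List (List (Bool × ℕ))) (u : List (Bool × ℕ))

theorem foldl_parseStep_bits (l : List Bool) (b : Bool) (d : List Bool) :
    (l.map Letter.bit).foldl parseStep (r, u, b, d) = (r, u, b, l.reverse ++ d) := by
  induction l generalizing d with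
  | nil => rfl
  | cons x l ih => exact (ih (x :: d)).trans (by simp)

theorem foldl_parseStep_writeInt (z : ℤ) :
    (writeInt z).foldl parseStep (r, u, false, []) = (r, ofInt z :: u, false, []) := by
  have absolute_value (b : Bool) :
      (z.natAbs.bits.map Letter.bit ++ [Letter.comma]).foldl parseStep (r, u, b, []) =
        (r, (b, z.natAbs) :: u, false, []) := by
    rw [List.foldl_append, foldl_parseStep_bits]
    simp [parseStep, Letter.triple]
  unfold writeInt ofInt
  by_cases hz : z < 0
  · rw [if_pos hz, List.append_assoc, decide_eq_true hz]
    exact absolute_value true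
  · rw [if_neg hz, List.nil_append, decide_eq_false hz]
    exact absolute_value false

theorem foldl_parseStep_flatMap (l : List ℤ) :
    (l.flatMap writeInt).foldl parseStep (r, u, false, []) =
      (r, (l.map ofInt).reverse ++ u, false, []) := by
  induction l generalizing u with
  | nil => rfl
  | cons z l ih => simp [foldl_parseStep_writeInt, ih]

theorem foldl_parseStep_writeRow (l : List ℤ) :
    (writeRow l).foldl parseStep (r, [], false, []) = (l.map ofInt :: r, [], false, []) := by
  rw [writeRow, List.foldl_append, foldl_parseStep_flatMap]
  simp [parseStep, Letter.triple]

theorem foldl_parseStep_writeRows (L : List (List ℤ)) :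
    (writeRows L).foldl parseStep (r, [], false, []) =
      ((L.map (List.map ofInt)).reverse ++ r, [], false, []) := by
  induction L generalizing r with
  | nil => rfl
  | cons l L ih =>
    rw [writeRows, List.flatMap_cons, List.foldl_append, foldl_parseStep_writeRow]
    exact (ih _).trans (by simp)

end ParseWrite

theorem parse_writeRows (L : List (List ℤ)) : parse (writeRows L) = L.map (List.map ofInt) := by
  rw [parse, foldl_parseStep_writeRows]
  simp

/-- The absolute values of the numbers in a row. -/
def nats (l : List (Bool × ℕ)) : List ℕ := l.map Prod.snd

/-- The fraction with numerator `x` and denominator `d`. -/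
def toFrac (x : Bool × ℕ) (d : ℕ) : Frac :=
  bif x.1 then (0, x.2, d.toPNat') else (x.2, 0, d.toPNat')

/-- One step of reading a list of fractions, from right to left. The first component of the state
tells whether a denominator has been read, and which one. -/
def fracStep (x : Bool × ℕ) (s : (Bool × ℕ) × List Frac) : (Bool × ℕ) × List Frac :=
  bif s.1.1 then ((false, 0), toFrac x s.1.2 :: s.2) else ((true, x.2), s.2)

/-- The fractions in a row of numerators and denominators. -/
def fracs (l : List (Bool × ℕ)) : List Frac := (l.foldr fracStep ((false, 0), [])).2

theorem val_toFrac (q : ℚ) : (toFrac (ofInt q.num) q.den).val = q := by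
  have den : ((q.den.toPNat' : ℕ+) : ℕ) = q.den := by rw [Nat.toPNat'_coe, if_pos q.den_pos]
  unfold toFrac ofInt
  by_cases hq : q.num < 0
  · have natAbs : ((q.num.natAbs : ℕ) : ℚ) = -(q.num : ℚ) := by
      rw [← Int.cast_natCast, Int.ofNat_natAbs_of_nonpos hq.le, Int.cast_neg]
    simp [hq, Frac.val, den, natAbs, Rat.num_div_den]
  · have natAbs : ((q.num.natAbs : ℕ) : ℚ) = (q.num : ℚ) := by
      rw [← Int.cast_natCast, Int.natAbs_of_nonneg (not_lt.1 hq)]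
    simp [hq, Frac.val, den, natAbs, Rat.num_div_den]

theorem fracs_map_ofInt (l : List ℚ) :
    fracs ((l.flatMap fun q => [q.num, (q.den : ℤ)]).map ofInt) =
      l.map fun q => toFrac (ofInt q.num) q.den := by
  suffices ((l.flatMap fun q => [q.num, (q.den : ℤ)]).map ofInt).foldr fracStep ((false, 0), []) =
      ((false, 0), l.map fun q => toFrac (ofInt q.num) q.den) from congrArg Prod.snd this
  induction l with
  | nil => rfl
  | cons q l ih => simp [ih, fracStep, ofInt]

theorem map_val_fracs (l : List ℚ) :
    (fracs ((l.flatMap fun q => [q.num, (q.den : ℤ)]).map ofInt)).map Frac.val = l := by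
  simp [fracs_map_ofInt, Function.comp_def, val_toFrac]

section PolyTime

variable {α : Type} [Coded α]

theorem size_parseStep_bound (s : ParseState) (l : Letter) :
    size (parseStep s l).1 + 2 * size (parseStep s l).2.1 + 4 * size (parseStep s l).2.2.2 ≤
      size s.1 + 2 * size s.2.1 + 4 * size s.2.2.2 + 20 := by
  obtain ⟨r, u, b, d⟩ := s
  have := size_ofBits_le d.reverse
  rw [size_reverse] at this
  rcases l with b | _ | _ | _ <;>
    simp only [parseStep, Letter.triple, cond_true, cond_false, size_cons, size_pair, size_bool,
      size_reverse, size_nil] <;> omega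

theorem polyTime_parse : PolyTime parse := by
  have step : PolyTime fun x : List Letter × Letter × ParseState => parseStep x.2.2 x.2.1 := by
    unfold parseStep
    fun_prop
  have : PolyTime fun l : List Letter => l.foldl parseStep ([], [], false, []) := by
    refine PolyTime.foldl_of_growth (h := fun _ => parseStep) (C := 10) (K := fun _ => 20)
      (ν := fun s => size s.1 + 2 * size s.2.1 + 4 * size s.2.2.2) .id (.const _) step ?_
      (.const _) (.const 20) fun _ s l _ => size_parseStep_bound s l
    rintro ⟨r, u, b, d⟩
    simp only [size_pair, size_bool]
    omega
  unfold parse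
  fun_prop

@[fun_prop] theorem PolyTime.parse {f : α → List Letter} (hf : PolyTime f) :
    PolyTime fun x => parse (f x) := polyTime_parse.comp hf

@[fun_prop] theorem PolyTime.nats {f : α → List (Bool × ℕ)} (hf : PolyTime f) :
    PolyTime fun x => nats (f x) :=
  PolyTime.map (h := fun _ => Prod.snd) hf (by fun_prop)

@[fun_prop] theorem PolyTime.toFrac {f : α → Bool × ℕ} {g : α → ℕ} (hf : PolyTime f)
    (hg : PolyTime g) : PolyTime fun x => toFrac (f x) (g x) := by
  unfold Manipulation.toFrac
  fun_prop

theorem size_toFrac_le (x : Bool × ℕ) (d : ℕ) : size (toFrac x d) ≤ 2 * size x + size d + 6 := by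
  obtain ⟨b, n⟩ := x
  have := size_toPNat'_le d
  have : size (0 : ℕ) = 0 := rfl
  cases b <;> simp only [toFrac, cond_true, cond_false, size_pair, size_bool] <;> omega

@[fun_prop] theorem PolyTime.fracs {f : α → List (Bool × ℕ)} (hf : PolyTime f) :
    PolyTime fun x => fracs (f x) := by
  have step : PolyTime fun x : α × (Bool × ℕ) × (Bool × ℕ) × List Frac =>
      fracStep x.2.1 x.2.2 := by
    unfold fracStep
    fun_prop
  have : PolyTime fun x => (f x).foldr fracStep ((false, 0), []) := by
    refine PolyTime.foldr_of_growth (h := fun _ => fracStep) (C := 10)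
      (K := fun x => 20 * size (f x) + 20) (ν := fun s => 2 * size s.1.2 + size s.2) hf (.const _)
      step ?_ (.const _) (((PolyBounded.const 20).mul hf.polyBounded_size).add (.const 20)) ?_
    · rintro ⟨⟨b, n⟩, l⟩
      simp only [size_pair, size_bool]
      omega
    · rintro c ⟨⟨b, n⟩, l⟩ x hx
      have := size_le_of_mem hx
      have := size_snd_le x
      have := size_toFrac_le x n
      have : size (0 : ℕ) = 0 := rfl
      cases b <;> simp only [fracStep, cond_true, cond_false, size_cons] <;> omega
  exact PolyTime.snd.comp this

end PolyTime

/-! ### The algorithm -/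

section Lookup

variable {β : Type}

/-- One step of the search for the key `c`: as long as it has not been found, the keys and the
values are discarded together. -/
def lookupStep (c : ℕ) (s : Bool × List β) (x : ℕ) : Bool × List β :=
  bif s.1 then s else bif x.beq c then (true, s.2) else (false, s.2.tail)

/-- The entry of `vs` at the place where `c` stands in `ks`, with default value `d`. -/
def lookup (d : β) (c : ℕ) (ks : List ℕ) (vs : List β) : β :=
  (ks.foldl (lookupStep c) (false, vs)).2.headD d

theorem lookup_cons (d : β) (c x : ℕ) (ks : List ℕ) (vs : List β) :
    lookup d c (x :: ks) vs = bif x.beq c then vs.headD d else lookup d c ks vs.tail := by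
  have found (ks : List ℕ) : ks.foldl (lookupStep c) (true, vs) = (true, vs) := by
    induction ks with
    | nil => rfl
    | cons _ _ ih => exact ih
  cases hx : x.beq c <;> simp [lookup, lookupStep, hx, found]

theorem lookup_getElem (d : β) {ks : List ℕ} (vs : List β) (hks : ks.Nodup) (i : ℕ)
    (hi : i < ks.length) (hi' : i < vs.length) : lookup d ks[i] ks vs = vs[i] := by
  induction ks generalizing vs i with
  | nil => simp at hi
  | cons x ks ih =>
    rw [List.nodup_cons] at hks
    cases vs with
    | nil => simp at hi'
    | cons y vs =>
      rw [lookup_cons]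
      cases i with
      | zero => simp
      | succ i =>
        have hi : i < ks.length := by simpa using hi
        have : x.beq ks[i] = false := Bool.eq_false_iff.2 fun h =>
          hks.1 (Nat.eq_of_beq_eq_true h ▸ List.getElem_mem hi)
        simpa [this] using ih vs hks.2 i hi (by simpa using hi')

theorem PolyTime.lookup {α : Type} [Coded α] [Coded β] {d : β} {f : α → ℕ} {g : α → List ℕ}
    {h : α → List β} (hf : PolyTime f) (hg : PolyTime g) (hh : PolyTime h) :
    PolyTime fun x => lookup d (f x) (g x) (h x) := by
  have step : PolyTime fun x : α × ℕ × Bool × List β => lookupStep (f x.1) x.2.2 x.2.1 := by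
    unfold lookupStep
    fun_prop
  have : PolyTime fun x => (g x).foldl (lookupStep (f x)) (false, h x) := by
    refine foldl_of_growth (ν := size) (C := 1) (K := fun _ => 0) hg ((const _).pair hh) step
      (by simp) ((const _).pair hh).polyBounded_size (.const 0) fun c s x _ => ?_
    obtain ⟨_ | _, vs⟩ := s
    · have := size_tail_le vs
      cases hx : x.beq (f c) <;> simp [lookupStep, hx, this]
    · simp [lookupStep]
  unfold Manipulation.lookup
  fun_prop

end Lookup

/-- The points that the candidate `c` gets from the vote `v`. -/
def pointsOf (A : List Frac) (c : ℕ) (v : List ℕ) : Frac := lookup Frac.zero c v A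

/-- The score of the candidate `c`. -/
def total (A : List Frac) (P : List (List ℕ)) (c : ℕ) : Frac := Frac.sum (P.map (pointsOf A c))

/-- Whether `a` comes before `b` in the list `t`. -/
def before (t : List ℕ) (a b : ℕ) : Bool :=
  t.foldr (fun z s => bif z.beq a then true else bif z.beq b then false else s) false

/-- Whether `x ≤ y`, with equality allowed only if `w` holds. -/
def below (w : Bool) (x y : Frac) : Bool := bif w then x.ble y else !(y.ble x)

/-- Whether `x` is the winner. -/
def isWinner (A : List Frac) (t : List ℕ) (P : List (List ℕ)) (x : ℕ) : Bool :=
  t.all fun d => below (before t x d) (total A P d) (total A P x)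

/-- The advantage that `y` gains over `x`, when the voter with the vote `v` puts `x` first and
`y` second. -/
def gainOf (A : List Frac) (x y : ℕ) (v : List ℕ) : Frac :=
  ((A.tail.headD Frac.zero).add (A.headD Frac.zero).neg).add
    ((pointsOf A x v).add (pointsOf A y v).neg)

/-- For each threshold `τ ≥ 0`, an upper bound for the sums of at most `k` of the fractions in
`l`. -/
def relaxedSum (k : ℕ) (l : List Frac) (τ : Frac) : Frac :=
  (τ.smul k).add (Frac.sum (l.map fun g => (g.add τ.neg).pos))

/-- Whether `k` voters can make `y` overtake `x`. -/
def canOvertake (A : List Frac) (t : List ℕ) (P : List (List ℕ)) (k x y : ℕ) : Bool :=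
  (Frac.zero :: P.map (gainOf A x y)).all fun τ => !(Frac.zero.ble τ) ||
    below (before t y x) ((total A P x).add (total A P y).neg)
      (relaxedSum k (P.map (gainOf A x y)) τ)

/-- Whether there is a coalition against `y` with at most `k` members. -/
def solveFor (A : List Frac) (t : List ℕ) (P : List (List ℕ)) (k y : ℕ) : Bool :=
  t.any fun x => isWinner A t P x && (!(x.beq y) && canOvertake A t P k x y)

section Rows

variable (rows : List (List (Bool × ℕ)))

/-- The scoring vector of the parsed election. -/
def scoreRow : List Frac := fracs (rows.headD [])

/-- The tie-breaking order of the parsed election. -/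
def tieRow : List ℕ := nats (rows.tail.headD [])

/-- The votes of the parsed election. -/
def voteRows : List (List ℕ) := rows.tail.tail.map nats

end Rows

/-- The decision algorithm for CPMSW. -/
def solveCPMSW (l : List Letter) : Bool :=
  let question := nats ((parse l).headD [])
  let rows := (parse l).tail
  solveFor (scoreRow rows) (tieRow rows) (voteRows rows) (question.tail.headD 0) (question.headD 0)

/-- The decision algorithm for CPMS. -/
def solveCPMS (l : List Letter) : Bool :=
  let question := nats ((parse l).headD [])
  let rows := (parse l).tail
  (tieRow rows).any fun y =>
    solveFor (scoreRow rows) (tieRow rows) (voteRows rows) (question.headD 0) y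

section PolyTime

variable {α : Type} [Coded α] {A : α → List Frac} {t : α → List ℕ} {P : α → List (List ℕ)}
  {k x y : α → ℕ}

@[fun_prop] theorem PolyTime.pointsOf {v : α → List ℕ} (hA : PolyTime A) (hx : PolyTime x)
    (hv : PolyTime v) : PolyTime fun i => pointsOf (A i) (x i) (v i) :=
  PolyTime.lookup hx hv hA

@[fun_prop] theorem PolyTime.total (hA : PolyTime A) (hP : PolyTime P) (hx : PolyTime x) :
    PolyTime fun i => total (A i) (P i) (x i) :=
  (PolyTime.map (h := fun i => Manipulation.pointsOf (A i) (x i)) hP (by fun_prop)).frac_sum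

@[fun_prop] theorem PolyTime.before (ht : PolyTime t) (hx : PolyTime x) (hy : PolyTime y) :
    PolyTime fun i => before (t i) (x i) (y i) :=
  PolyTime.foldr ht (.const _) (by fun_prop) (.const 1) fun _ _ _ => le_rfl

@[fun_prop] theorem PolyTime.below {w : α → Bool} {f g : α → Frac} (hw : PolyTime w)
    (hf : PolyTime f) (hg : PolyTime g) : PolyTime fun i => below (w i) (f i) (g i) := by
  unfold Manipulation.below
  fun_prop

@[fun_prop] theorem PolyTime.isWinner (hA : PolyTime A) (ht : PolyTime t) (hP : PolyTime P)
    (hx : PolyTime x) : PolyTime fun i => isWinner (A i) (t i) (P i) (x i) :=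
  PolyTime.all ht (by fun_prop)

@[fun_prop] theorem PolyTime.gainOf {v : α → List ℕ} (hA : PolyTime A) (hx : PolyTime x)
    (hy : PolyTime y) (hv : PolyTime v) : PolyTime fun i => gainOf (A i) (x i) (y i) (v i) := by
  unfold Manipulation.gainOf
  fun_prop

@[fun_prop] theorem PolyTime.relaxedSum {l : α → List Frac} {τ : α → Frac} (hk : PolyTime k)
    (hl : PolyTime l) (hτ : PolyTime τ) : PolyTime fun i => relaxedSum (k i) (l i) (τ i) := by
  have excess : PolyTime fun i => (l i).map fun g => (g.add (τ i).neg).pos :=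
    PolyTime.map hl (by fun_prop)
  unfold Manipulation.relaxedSum
  fun_prop

@[fun_prop] theorem PolyTime.canOvertake (hA : PolyTime A) (ht : PolyTime t) (hP : PolyTime P)
    (hk : PolyTime k) (hx : PolyTime x) (hy : PolyTime y) :
    PolyTime fun i => canOvertake (A i) (t i) (P i) (k i) (x i) (y i) := by
  have gains : PolyTime fun i => (P i).map (Manipulation.gainOf (A i) (x i) (y i)) :=
    PolyTime.map hP (by fun_prop)
  have gains' := gains.comp (PolyTime.fst (β := Frac))
  exact PolyTime.all ((PolyTime.const Frac.zero).cons gains) (by fun_prop)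

@[fun_prop] theorem PolyTime.solveFor (hA : PolyTime A) (ht : PolyTime t) (hP : PolyTime P)
    (hk : PolyTime k) (hy : PolyTime y) :
    PolyTime fun i => solveFor (A i) (t i) (P i) (k i) (y i) :=
  PolyTime.any ht (by fun_prop)

variable {rows : α → List (List (Bool × ℕ))}

@[fun_prop] theorem PolyTime.scoreRow (h : PolyTime rows) :
    PolyTime fun i => scoreRow (rows i) := by
  unfold Manipulation.scoreRow
  fun_prop

@[fun_prop] theorem PolyTime.tieRow (h : PolyTime rows) : PolyTime fun i => tieRow (rows i) := by
  unfold Manipulation.tieRow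
  fun_prop

@[fun_prop] theorem PolyTime.voteRows (h : PolyTime rows) : PolyTime fun i => voteRows (rows i) :=
  PolyTime.map (h := fun _ => Manipulation.nats) (by fun_prop) (by fun_prop)

theorem polyTime_solveCPMSW : PolyTime solveCPMSW := by
  unfold solveCPMSW
  fun_prop

theorem polyTime_solveCPMS : PolyTime solveCPMS :=
  PolyTime.any (by fun_prop) (by fun_prop)

end PolyTime

/-! ### Correctness of the algorithm -/

/-- The row of natural numbers that represents the preference `v` in the parsed input. -/
def natRow {m : ℕ} (v : Preference m) : List ℕ := List.ofFn fun p => (v.symm p : ℕ)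

section NatRow

variable {m : ℕ} (v : Preference m)

theorem nats_rowOfPreference : nats ((rowOfPreference v).map ofInt) = natRow v := by
  simp [nats, rowOfPreference, natRow, ofInt, List.map_ofFn, Function.comp_def]

theorem length_natRow : (natRow v).length = m := List.length_ofFn

theorem nodup_natRow : (natRow v).Nodup :=
  List.nodup_ofFn.2 fun _ _ h => v.symm.injective (Fin.ext h)

theorem mem_natRow (c : ℕ) : c ∈ natRow v ↔ ∃ d : Fin m, (d : ℕ) = c := by
  rw [natRow, List.mem_ofFn]
  exact (v.symm.surjective.exists (p := fun d : Fin m => (d : ℕ) = c)).symm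

theorem natRow_getElem (c : Fin m) (h : (v c : ℕ) < (natRow v).length) :
    (natRow v)[(v c : ℕ)] = c := by
  simp [natRow]

theorem idxOf_natRow (c : Fin m) : (natRow v).idxOf (c : ℕ) = v c := by
  have hc : (v c : ℕ) < (natRow v).length := by rw [length_natRow]; exact (v c).isLt
  conv_lhs => rw [← natRow_getElem v c hc]
  exact (nodup_natRow v).idxOf_getElem _ hc

end NatRow

theorem before_iff {l : List ℕ} (a : ℕ) {b : ℕ} (hb : b ∈ l) :
    before l a b = true ↔ l.idxOf a ≤ l.idxOf b := by
  induction l with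
  | nil => simp at hb
  | cons z l ih =>
    have before_cons : before (z :: l) a b =
      bif z.beq a then true else bif z.beq b then false else before l a b := rfl
    have beq_eq (c : ℕ) : z.beq c = decide (z = c) :=
      Bool.eq_iff_iff.2 (by rw [Nat.beq_eq, decide_eq_true_iff])
    rw [before_cons, beq_eq, beq_eq, List.idxOf_cons, List.idxOf_cons, beq_eq_decide,
      beq_eq_decide]
    by_cases ha : z = a
    · simp [ha]
    by_cases hz : z = b
    · subst hz
      simp [ha]
    · simpa [ha, hz] using ih ((List.mem_cons.1 hb).resolve_left (Ne.symm hz))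

theorem before_natRow {m : ℕ} (t : Preference m) (a b : Fin m) :
    before (natRow t) a b = true ↔ t a ≤ t b := by
  rw [before_iff _ ((mem_natRow t b).2 ⟨b, rfl⟩), idxOf_natRow, idxOf_natRow, Fin.le_def]

theorem below_iff (w : Bool) (x y : Frac) :
    below w x y = true ↔ LeTie (w = true) x.val y.val := by
  cases w
  · rw [below, cond_false, Bool.not_eq_true', ← Bool.not_eq_true, Frac.ble_iff, not_le, LeTie]
    simp [lt_iff_le_and_ne]
  · rw [below, cond_true, Frac.ble_iff, LeTie]
    simp

theorem val_relaxedSum {n : ℕ} (k : ℕ) {l : List Frac} {g : Fin n → ℚ}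
    (hl : l.map Frac.val = List.ofFn g) (τ : Frac) :
    (relaxedSum k l τ).val = k • τ.val + ∑ v, max (g v - τ.val) 0 := by
  have excess : l.map (Frac.val ∘ fun f => (f.add τ.neg).pos) =
      List.ofFn fun v => max (g v - τ.val) 0 := by
    have := congrArg (List.map fun q => max (q - τ.val) 0) hl
    rw [List.map_map, List.map_ofFn] at this
    rw [← Function.comp_def (fun q => max (q - τ.val) 0) g, ← this]
    simp only [Function.comp_def, Frac.val_pos, Frac.val_add, Frac.val_neg, sub_eq_add_neg]
  rw [relaxedSum, Frac.val_add, Frac.val_smul, Frac.val_sum, List.map_map, excess, List.sum_ofFn,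
    nsmul_eq_mul]

theorem forall_mem_zero_cons_iff {n : ℕ} {l : List Frac} {g : Fin n → ℚ}
    (hl : l.map Frac.val = List.ofFn g) {p : ℚ → Prop} :
    (∀ τ ∈ Frac.zero :: l, p τ.val) ↔ ∀ q ∈ insert 0 (Set.range g), p q := by
  have mem_iff (q : ℚ) : q ∈ insert 0 (Set.range g) ↔ q ∈ (Frac.zero :: l).map Frac.val := by
    simp [hl]
  simp only [mem_iff, List.forall_mem_map]

section Correctness

variable {m n : ℕ} {s : ScoringVector m} {A : List Frac} (hA : A.map Frac.val = List.ofFn s.α)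
  (t : Preference m) (P : Fin n → Preference m)

include hA

theorem val_pointsOf (v : Preference m) (c : Fin m) :
    (pointsOf A c (natRow v)).val = s.α (v c) := by
  have length_A : A.length = m := by simpa using congrArg List.length hA
  have hc : (v c : ℕ) < (natRow v).length := by rw [length_natRow]; exact (v c).isLt
  have hc' : (v c : ℕ) < A.length := by rw [length_A]; exact (v c).isLt
  have lookup_eq := lookup_getElem Frac.zero A (nodup_natRow v) (v c) hc hc'
  rw [natRow_getElem] at lookup_eq
  rw [pointsOf, lookup_eq, ← List.getElem_map Frac.val (h := by simpa using hc')]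
  simp [hA]

theorem val_total (c : Fin m) : (total A ((List.ofFn P).map natRow) c).val = s.score P c := by
  rw [total, Frac.val_sum, List.map_ofFn, List.map_ofFn, List.map_ofFn, List.sum_ofFn]
  exact Finset.sum_congr rfl fun i _ => val_pointsOf hA (P i) c

theorem val_gainOf (x y : Fin m) (i : Fin n) :
    (gainOf A x y (natRow (P i))).val = s.gain P x y i := by
  have two_le := s.two_le
  have getElem_A (i : ℕ) (hi : i < m) : (A.map Frac.val)[i]? = some (s.α ⟨i, hi⟩) := by
    simp [hA, hi]
  have first := getElem_A 0 (by omega)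
  have second := getElem_A 1 two_le
  obtain _ | ⟨a, _ | ⟨b, A⟩⟩ := A
  · simp at first
  · simp at second
  replace first : a.val = s.α ⟨0, by omega⟩ := by simpa using first
  replace second : b.val = s.α ⟨1, two_le⟩ := by simpa using second
  simp only [gainOf, Frac.val_add, Frac.val_neg, val_pointsOf hA, ScoringVector.gain,
    List.tail_cons, List.headD_cons, first, second, sub_eq_add_neg]

theorem map_val_gains (x y : Fin m) :
    (((List.ofFn P).map natRow).map (gainOf A x y)).map Frac.val = List.ofFn (s.gain P x y) := by
  rw [List.map_ofFn, List.map_ofFn, List.map_ofFn]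
  exact congrArg List.ofFn (funext (val_gainOf hA P x y))

theorem isWinner_iff (x : Fin m) :
    isWinner A (natRow t) ((List.ofFn P).map natRow) x = true ↔ s.IsTop t P x := by
  simp only [isWinner, List.all_eq_true, mem_natRow, forall_exists_index,
    forall_apply_eq_imp_iff, below_iff, val_total hA, before_natRow, ScoringVector.IsTop]

theorem canOvertake_iff (k : ℕ) (x y : Fin m) :
    canOvertake A (natRow t) ((List.ofFn P).map natRow) k x y = true ↔
      ∃ M : Finset (Fin n), M.card ≤ k ∧
        LeTie (t y ≤ t x) (s.score P x - s.score P y) (∑ v ∈ M, s.gain P x y v) := by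
  have gains := map_val_gains hA P x y
  rw [exists_sum_iff_relaxation (s.gain P x y) k fun _ _ hab h => LeTie.mono h hab,
    ← forall_mem_zero_cons_iff gains, canOvertake, List.all_eq_true]
  refine forall₂_congr fun τ _ => ?_
  rw [Bool.or_eq_true, Bool.not_eq_true', ← Bool.not_eq_true, Frac.ble_iff, Frac.val_zero,
    below_iff, val_relaxedSum k gains, Frac.val_add, Frac.val_neg, val_total hA, val_total hA,
    before_natRow, ← sub_eq_add_neg]
  exact imp_iff_not_or.symm

theorem solveFor_iff (hs : s.FirstGapMinimal) (k : ℕ) (y : Fin m) :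
    solveFor A (natRow t) ((List.ofFn P).map natRow) k y = true ↔
      ∃ M : Finset (Fin n), M.card ≤ k ∧ IsCoalitionAgainst (s.winner t) P M y := by
  have ne_iff (x : Fin m) : (!((x : ℕ).beq y)) = true ↔ y ≠ x := by
    rw [Bool.not_eq_true', ← Bool.not_eq_true, Nat.beq_eq, Fin.val_inj, eq_comm]
  simp only [solveFor, List.any_eq_true, mem_natRow, exists_exists_eq_and, Bool.and_eq_true, ne_iff,
    isWinner_iff hA, canOvertake_iff hA, ScoringVector.isTop_iff, exists_eq_left',
    hs.isCoalitionAgainst_iff]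
  constructor
  · rintro ⟨hy, M, hM, h⟩
    exact ⟨M, hM, hy, h⟩
  · rintro ⟨M, hM, hy, h⟩
    exact ⟨hy, M, hM, h⟩

end Correctness

section Write

variable (E : Election)

theorem map_val_scoreRow :
    (scoreRow (E.rows.map (List.map ofInt))).map Frac.val = List.ofFn E.scores.α :=
  map_val_fracs _

theorem tieRow_rows : tieRow (E.rows.map (List.map ofInt)) = natRow E.tie :=
  nats_rowOfPreference E.tie

theorem exists_mem_tieRow_iff {p : ℕ → Prop} :
    (∃ y ∈ tieRow (E.rows.map (List.map ofInt)), p y) ↔ ∃ y : Fin E.m, p y := by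
  simp only [tieRow_rows, mem_natRow, exists_exists_eq_and]

theorem voteRows_rows :
    voteRows (E.rows.map (List.map ofInt)) = (List.ofFn E.profile).map natRow := by
  rw [List.map_ofFn]
  simp only [voteRows, Election.rows, List.map_cons, List.tail_cons, List.map_ofFn]
  exact congrArg List.ofFn (funext fun i => nats_rowOfPreference (E.profile i))

theorem solveFor_rows_iff (hs : E.scores.FirstGapMinimal) (k : ℕ) (y : Fin E.m) :
    solveFor (scoreRow (E.rows.map (List.map ofInt))) (tieRow (E.rows.map (List.map ofInt)))
        (voteRows (E.rows.map (List.map ofInt))) k y = true ↔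
      ∃ M : Finset (Fin E.n), M.card ≤ k ∧ IsCoalitionAgainst E.rule E.profile M y := by
  rw [tieRow_rows, voteRows_rows]
  exact solveFor_iff (map_val_scoreRow E) E.tie E.profile hs k y

end Write

theorem solveCPMSW_write (I : CPMSWInstance) : solveCPMSW I.write = true ↔ CPMSW I := by
  rw [solveCPMSW, CPMSWInstance.write, parse_writeRows]
  exact solveFor_rows_iff I.election I.gap I.k I.y

theorem solveCPMS_write (I : CPMSInstance) : solveCPMS I.write = true ↔ CPMS I := by
  rw [solveCPMS, CPMSInstance.write, parse_writeRows]
  refine List.any_eq_true.trans <| (exists_mem_tieRow_iff I.election).trans ?_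
  simp only [CPMS, IsCoalition, ← exists_and_left]
  rw [exists_comm]
  exact exists_congr fun y => solveFor_rows_iff I.election I.gap I.k y

end Manipulation

theorem mainTheorem3 :
    Manipulation.InP Manipulation.cpmswEncoding Manipulation.CPMSW ∧
      Manipulation.InP Manipulation.cpmsEncoding Manipulation.CPMS := by
  exact ⟨Manipulation.inP_of_polyTime _ _ Manipulation.polyTime_solveCPMSW
      Manipulation.solveCPMSW_write,
    Manipulation.inP_of_polyTime _ _ Manipulation.polyTime_solveCPMS
      Manipulation.solveCPMS_write⟩
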